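/- Let $k$ be a field and let $m,n\ge 0$ be integers. A superalgebra is a $\mathbb Z/2$-graded $k$-algebra $A=A_0\oplus A_1$, with parity $p$; it is supercommutative if $xy=(-1)^{p(x)p(y)}yx$ for all homogeneous $x,y$. The tensor product $A\otimes A$ has the total parity and the product $(a\otimes b)(a'\otimes b')=(-1)^{p(b)p(a')}aa'\otimes bb'$. A (super) bialgebra structure on $A$ consists of morphisms of superalgebras $\Delta:A\to A\otimes A$ and $\epsilon:A\to k$ that form a coassociative and counital coalgebra. Let $k[GL(m|n)]$ be the superalgebra generated by $a_{ij}$ ($1\le i,j\le m+n$) and $d_1^{-1},d_2^{-1}$, where $a_{ij}$ is even if $i,j\le m$ or $i,j>m$ and odd otherwise, and $d_1^{-1},d_2^{-1}$ are even, subject to the relations that the generators supercommute, that the odd generators have square zero, and that $d_1^{-1}d_1=1$, $d_2^{-1}d_2=1$, where $d_1=\det X_{11}$, $d_2=\det X_{22}$ and $$\begin{pmatrix}X_{11}&\Xi_{12}\\ \Xi_{21}&X_{22}\end{pmatrix}=(a_{ij})$$ is the decomposition into blocks of sizes $m$ and $n$. Let $S_{22}(X_{22})$ be the inverse of $X_{22}$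 given by Cramer's rule with $d_2^{-1}$, let $$\mathrm{Ber}=\det(S_{22}(X_{22}))\,\det\bigl(X_{11}-\Xi_{12}S_{22}(X_{22})\Xi_{21}\bigr),$$ and let $k[SL(m|n)]$ be the quotient of $k[GL(m|n)]$ by the ideal generated by $\mathrm{Ber}-1$. Proposition. $k[GL(m|n)]$ and $k[SL(m|n)]$ are supercommutative, and each of them has a bialgebra structure with comultiplication $$\Delta(a_{ij})=\sum_{l=1}^{m+n}a_{il}\otimes a_{lj},\qquad \Delta(d_s^{-1})=\sum_{i=1}^{2mn+2}(-1)^{i-1}\,(d_s^{-i}\otimes d_s^{-i})\,\bigl(\Delta(d_s)-d_s\otimes d_s\bigr)^{i-1}\quad(s=1,2),$$ where $d_s^{-i}=(d_s^{-1})^i$, and counit $$\epsilon(a_{ij})=\delta_{ij},\qquad \epsilon(d_1^{-1})=\epsilon(d_2^{-1})=1.$$ Moreover, for this structure on $k[GL(m|n)]$ the Berezinian is grouplike: $\Delta(\mathrm{Ber})=\mathrm{Ber}\otimes\mathrm{Ber}$. -/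

import Mathlib

open scoped TensorProduct DirectSum

noncomputable section

namespace SuperGroup

/-! ### Parity gradings on free algebras and on quotients by homogeneous relations -/

section Grading

variable {k : Type*} [CommRing k]

/-- The part of parity `i` of the free algebra on `X`, where the generator `x` has parity `p x`:
the span of the words `x₁ ⋯ xᵣ` with `p x₁ + ⋯ + p xᵣ = i`. -/
def freePart (k : Type*) [CommRing k] {X : Type*} (p : X → ZMod 2) (i : ZMod 2) :
    Submodule k (FreeAlgebra k X) :=
  Submodule.span k
    {w | ∃ l : List X, (l.map p).sum = i ∧ w = (l.map (FreeAlgebra.ι k)).prod}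

theorem ι_mem_freePart {X : Type*} (p : X → ZMod 2) (x : X) :
    FreeAlgebra.ι k x ∈ freePart k p (p x) :=
  Submodule.subset_span ⟨[x], by simp, by simp⟩

instance freePart.gradedMonoid {X : Type*} (p : X → ZMod 2) :
    SetLike.GradedMonoid (freePart k p) where
  one_mem := Submodule.subset_span ⟨[], by simp, by simp⟩
  mul_mem i j a b ha hb := by
    have h : a * b ∈ freePart k p i * freePart k p j := Submodule.mul_mem_mul ha hb
    rw [freePart, freePart, Submodule.span_mul_span] at h
    refine Submodule.span_mono ?_ h
    rintro _ ⟨_, ⟨l, hl, rfl⟩, _, ⟨l', hl', rfl⟩, rfl⟩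
    exact ⟨l ++ l', by simp [hl, hl'], by simp⟩

/-- The free algebra is a superalgebra. -/
instance freePart.gradedAlgebra {X : Type*} (p : X → ZMod 2) :
    GradedAlgebra (freePart k p) :=
  GradedAlgebra.ofAlgHom (freePart k p)
    (FreeAlgebra.lift k fun x =>
      DirectSum.of (fun i => freePart k p i) (p x) ⟨FreeAlgebra.ι k x, ι_mem_freePart p x⟩)
    (by
      ext x
      simp)
    (by
      rintro i ⟨x, hx⟩
      dsimp only
      induction hx using Submodule.span_induction with
      | mem x h =>
        obtain ⟨l, rfl, rfl⟩ := h
        induction l with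
        | nil => exact map_one _
        | cons x l ih =>
          simp only [List.map_cons, List.prod_cons, map_mul, FreeAlgebra.lift_ι_apply]
          rw [ih, DirectSum.of_mul_of]
          exact DirectSum.of_eq_of_gradedMonoid_eq
            (Sigma.subtype_ext (List.sum_cons (a := p x) (l := l.map p)).symm rfl)
      | zero => rw [map_zero]; exact (map_zero _).symm
      | add x y hx hy ihx ihy => rw [map_add, ihx, ihy, ← map_add]; rfl
      | smul c x hx ih =>
        rw [map_smul, ih]
        exact (map_smul (DirectSum.lof k (ZMod 2) (fun i => freePart k p i) i) c ⟨x, hx⟩).symm)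

variable {A : Type*} [Ring A] [Algebra k A]

/-- The part of parity `i` of the quotient of a superalgebra by relations: the image of the part
of parity `i`. -/
def quotPart (𝒜 : ZMod 2 → Submodule k A) (r : A → A → Prop) (i : ZMod 2) :
    Submodule k (RingQuot r) :=
  (𝒜 i).map (RingQuot.mkAlgHom k r).toLinearMap

theorem mk_mem_quotPart {𝒜 : ZMod 2 → Submodule k A} (r : A → A → Prop) {i : ZMod 2} {a : A}
    (ha : a ∈ 𝒜 i) : RingQuot.mkAlgHom k r a ∈ quotPart 𝒜 r i :=
  Submodule.mem_map_of_mem (f := (RingQuot.mkAlgHom k r).toLinearMap) ha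

theorem quotPart.gradedMonoid (𝒜 : ZMod 2 → Submodule k A) [GradedAlgebra 𝒜]
    (r : A → A → Prop) : SetLike.GradedMonoid (quotPart 𝒜 r) where
  one_mem := by
    simpa using mk_mem_quotPart r (SetLike.GradedOne.one_mem (A := 𝒜))
  mul_mem i j a b ha hb := by
    obtain ⟨a, ha, rfl⟩ := ha
    obtain ⟨b, hb, rfl⟩ := hb
    simpa using mk_mem_quotPart r (SetLike.GradedMul.mul_mem (A := 𝒜) ha hb)

/-- The quotient of a superalgebra by homogeneous relations is a superalgebra. -/
@[reducible]
def quotPart.gradedAlgebra (𝒜 : ZMod 2 → Submodule k A) [GradedAlgebra 𝒜] (r : A → A → Prop)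
    (hr : ∀ a b, r a b → ∃ i, a ∈ 𝒜 i ∧ b ∈ 𝒜 i) : GradedAlgebra (quotPart 𝒜 r) :=
  letI := quotPart.gradedMonoid 𝒜 r
  let ψ (i : ZMod 2) : 𝒜 i →ₗ[k] ⨁ i, quotPart 𝒜 r i :=
    (DirectSum.lof k (ZMod 2) (fun i => quotPart 𝒜 r i) i).comp
      (((RingQuot.mkAlgHom k r).toLinearMap.comp (𝒜 i).subtype).codRestrict (quotPart 𝒜 r i)
        fun x => mk_mem_quotPart r x.2)
  let φ : (⨁ i, 𝒜 i) →ₐ[k] ⨁ i, quotPart 𝒜 r i :=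
    DirectSum.toAlgebra k (fun i => 𝒜 i) ψ
      (DirectSum.of_eq_of_gradedMonoid_eq (Sigma.subtype_ext rfl (map_one (RingQuot.mkAlgHom k r))))
      (fun {i j} a b => by
        refine Eq.trans ?_ (DirectSum.of_mul_of (A := fun i => quotPart 𝒜 r i) _ _).symm
        exact DirectSum.of_eq_of_gradedMonoid_eq
          (Sigma.subtype_ext rfl (map_mul (RingQuot.mkAlgHom k r) _ _)))
  have hφ : ∀ i (a : A) (ha : a ∈ 𝒜 i), φ (DirectSum.decomposeAlgEquiv 𝒜 a) =
      DirectSum.of (fun i => quotPart 𝒜 r i) i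
        ⟨RingQuot.mkAlgHom k r a, mk_mem_quotPart r ha⟩ := by
    intro i a ha
    have h : DirectSum.decomposeAlgEquiv 𝒜 a = DirectSum.of (fun i => 𝒜 i) i ⟨a, ha⟩ :=
      DirectSum.decompose_of_mem 𝒜 ha
    rw [h]
    exact DirectSum.toAddMonoid_of (fun i => (ψ i).toAddMonoidHom) i ⟨a, ha⟩
  GradedAlgebra.ofAlgHom (quotPart 𝒜 r)
    (RingQuot.liftAlgHom k ⟨φ.comp (DirectSum.decomposeAlgEquiv 𝒜).toAlgHom, by
      intro a b hab
      obtain ⟨i, ha, hb⟩ := hr a b hab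
      refine (hφ i a ha).trans (Eq.trans ?_ (hφ i b hb).symm)
      congr 2
      exact RingQuot.mkAlgHom_rel k hab⟩)
    (by
      apply RingQuot.ringQuot_ext'
      ext a
      induction a using DirectSum.Decomposition.inductionOn 𝒜 with
      | zero => simp only [map_zero]
      | homogeneous a =>
        have h := hφ _ a.1 a.2
        simp only [AlgHom.comp_apply, RingQuot.liftAlgHom_mkAlgHom_apply]
        refine (congrArg (DirectSum.coeAlgHom (quotPart 𝒜 r)) h).trans ?_
        exact DirectSum.coeAlgHom_of _ _ _
      | add a b ha hb => rw [map_add, map_add, ha, hb])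
    (by
      rintro i ⟨x, hx⟩
      obtain ⟨a, ha, rfl⟩ := hx
      have h := hφ i a ha
      dsimp only
      refine Eq.trans ?_ h
      exact RingQuot.liftAlgHom_mkAlgHom_apply k _ _ a)

end Grading

/-! ### Superalgebras and super bialgebras -/

section Super

variable {k A : Type*} [CommRing k] [Ring A] [Algebra k A]

/-- `x y = (-1)^{p(x) p(y)} y x` for all homogeneous `x`, `y`. -/
def IsSupercommutative (𝒜 : ZMod 2 → Submodule k A) : Prop :=
  ∀ i j : ZMod 2, ∀ x ∈ 𝒜 i, ∀ y ∈ 𝒜 j, x * y = (-1 : ℤˣ) ^ (i * j) • (y * x)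

/-- A bialgebra structure on the superalgebra `A = 𝒜 0 ⊕ 𝒜 1`: a coassociative counital coalgebra
structure whose comultiplication `A → A ⊗ A` and counit `A → k` are morphisms of superalgebras.
Here `A ⊗ A` carries the multiplication
`(a ⊗ b) (a' ⊗ b') = (-1)^{p(b) p(a')} a a' ⊗ b b'` of `𝒜 ᵍ⊗[k] 𝒜`
and the total parity, and `k` is purely even. -/
structure SuperBialgebra (𝒜 : ZMod 2 → Submodule k A) [GradedAlgebra 𝒜]
    extends Coalgebra k A where
  comul_one : GradedTensorProduct.of k 𝒜 𝒜 (comul 1) = 1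
  comul_mul : ∀ a b : A, GradedTensorProduct.of k 𝒜 𝒜 (comul (a * b)) =
    GradedTensorProduct.of k 𝒜 𝒜 (comul a) * GradedTensorProduct.of k 𝒜 𝒜 (comul b)
  comul_mem : ∀ i : ZMod 2, ∀ a ∈ 𝒜 i, comul a ∈
    ⨆ j : ZMod 2, LinearMap.range (TensorProduct.map (𝒜 j).subtype (𝒜 (i - j)).subtype)
  counit_one : counit (1 : A) = 1
  counit_mul : ∀ a b : A, counit (a * b) = counit a * counit b
  counit_odd : ∀ a ∈ 𝒜 1, counit a = 0

/-- The comultiplication, with values in the graded tensor product. -/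
def SuperBialgebra.Δ {𝒜 : ZMod 2 → Submodule k A} [GradedAlgebra 𝒜] (S : SuperBialgebra 𝒜) :
    A →ₗ[k] 𝒜 ᵍ⊗[k] 𝒜 :=
  (GradedTensorProduct.of k 𝒜 𝒜).toLinearMap ∘ₗ S.toCoalgebra.comul

/-- The counit. -/
def SuperBialgebra.ε {𝒜 : ZMod 2 → Submodule k A} [GradedAlgebra 𝒜] (S : SuperBialgebra 𝒜) :
    A →ₗ[k] k :=
  S.toCoalgebra.counit

end Super

/-! ### Generic supermatrices, determinants and the Berezinian -/

/-- The generators `a i j` (the even `x i j` in the two diagonal blocks, the odd `ξ i j` in the two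
off-diagonal blocks), and the inverses of the determinants of the two diagonal blocks. -/
inductive Gen (m n : ℕ) : Type
  | a (i j : Fin m ⊕ Fin n) : Gen m n
  | dinv₁ : Gen m n
  | dinv₂ : Gen m n

/-- The parity of an index: the first `m` are even, the last `n` are odd. -/
def indexParity {m n : ℕ} : Fin m ⊕ Fin n → ZMod 2 :=
  Sum.elim (fun _ => 0) (fun _ => 1)

/-- The parity of a generator. -/
def Gen.parity {m n : ℕ} : Gen m n → ZMod 2
  | .a i j => indexParity i + indexParity j
  | .dinv₁ => 0
  | .dinv₂ => 0

section Matrices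

variable {B : Type*} [Ring B]

/-- The determinant `∑_σ sgn(σ) M_{1,σ(1)} ⋯ M_{r,σ(r)}` of a square matrix over a ring that need
not be commutative (it is used for matrices whose entries commute with each other). -/
def det {r : ℕ} (M : Matrix (Fin r) (Fin r) B) : B :=
  ∑ σ : Equiv.Perm (Fin r), Equiv.Perm.sign σ • (List.ofFn fun i => M i (σ i)).prod

/-- The determinant of the matrix obtained by suppressing row `i` and column `j`. -/
def minor : {r : ℕ} → Matrix (Fin r) (Fin r) B → Fin r → Fin r → B
  | 0, _, i, _ => i.elim0
  | _ + 1, M, i, j => det (M.submatrix i.succAbove j.succAbove)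

/-- The inverse matrix by Cramer's rule, given an inverse `e` of the determinant: the entry at
`(i, j)` is `(-1)^{i-j}` times the minor without row `j` and column `i`, times `e`. -/
def cramerInv {r : ℕ} (M : Matrix (Fin r) (Fin r) B) (e : B) : Matrix (Fin r) (Fin r) B :=
  Matrix.of fun i j => (-1) ^ ((i : ℕ) + (j : ℕ)) * minor M j i * e

variable {m n : ℕ} (g : Gen m n → B)

/-- The block `X₁₁` of the supermatrix with entries `g (a i j)`. -/
def X₁₁ : Matrix (Fin m) (Fin m) B := Matrix.of fun i j => g (.a (.inl i) (.inl j))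

/-- The block `Ξ₁₂`. -/
def Ξ₁₂ : Matrix (Fin m) (Fin n) B := Matrix.of fun i j => g (.a (.inl i) (.inr j))

/-- The block `Ξ₂₁`. -/
def Ξ₂₁ : Matrix (Fin n) (Fin m) B := Matrix.of fun i j => g (.a (.inr i) (.inl j))

/-- The block `X₂₂`. -/
def X₂₂ : Matrix (Fin n) (Fin n) B := Matrix.of fun i j => g (.a (.inr i) (.inr j))

/-- The inverse `S₂₂(X₂₂)` of the block `X₂₂`. -/
def S₂₂ : Matrix (Fin n) (Fin n) B := cramerInv (X₂₂ g) (g .dinv₂)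

/-- The Berezinian `det (S₂₂(X₂₂)) det (X₁₁ - Ξ₁₂ S₂₂(X₂₂) Ξ₂₁)`. -/
def ber : B := det (S₂₂ g) * det (X₁₁ g - Ξ₁₂ g * S₂₂ g * Ξ₂₁ g)

end Matrices

/-! ### Homogeneity of determinants -/

section Homogeneous

variable {k B : Type*} [CommRing k] [Ring B] [Algebra k B]
variable {ℬ : ZMod 2 → Submodule k B} [SetLike.GradedMonoid ℬ]

theorem mul_mem_zero {i j : ZMod 2} (h : i + j = 0) {a b : B} (ha : a ∈ ℬ i) (hb : b ∈ ℬ j) :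
    a * b ∈ ℬ 0 := h ▸ SetLike.GradedMul.mul_mem ha hb

theorem det_mem {r : ℕ} {M : Matrix (Fin r) (Fin r) B} (hM : ∀ i j, M i j ∈ ℬ 0) :
    det M ∈ ℬ 0 := by
  refine Submodule.sum_mem _ fun σ _ => ?_
  have h : (List.ofFn fun i => M i (σ i)).prod ∈ ℬ 0 := by
    have := SetLike.list_prod_ofFn_mem_graded (A := ℬ) (n := r) (fun _ => 0)
      (fun i => M i (σ i)) (fun i => hM _ _)
    simpa using this
  rcases Int.units_eq_one_or (Equiv.Perm.sign σ) with hs | hs <;> rw [hs]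
  · simpa using h
  · simpa using h

theorem minor_mem {r : ℕ} {M : Matrix (Fin r) (Fin r) B} (hM : ∀ i j, M i j ∈ ℬ 0)
    (i j : Fin r) : minor M i j ∈ ℬ 0 := by
  cases r with
  | zero => exact i.elim0
  | succ r => exact det_mem fun _ _ => hM _ _

theorem cramerInv_mem {r : ℕ} {M : Matrix (Fin r) (Fin r) B} {e : B}
    (hM : ∀ i j, M i j ∈ ℬ 0) (he : e ∈ ℬ 0) (i j : Fin r) : cramerInv M e i j ∈ ℬ 0 := by
  refine mul_mem_zero (add_zero 0) (mul_mem_zero (add_zero 0) ?_ (minor_mem hM j i)) he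
  rcases neg_one_pow_eq_or B ((i : ℕ) + (j : ℕ)) with h | h <;> rw [h]
  · exact SetLike.GradedOne.one_mem
  · exact Submodule.neg_mem _ SetLike.GradedOne.one_mem

theorem ber_mem {m n : ℕ} {g : Gen m n → B} (hg : ∀ x, g x ∈ ℬ x.parity) : ber g ∈ ℬ 0 := by
  have hS : ∀ i j, S₂₂ g i j ∈ ℬ 0 := cramerInv_mem (fun i j => hg (.a (.inr i) (.inr j))) (hg .dinv₂)
  refine mul_mem_zero (add_zero 0) (det_mem hS) (det_mem fun i j => ?_)
  refine Submodule.sub_mem _ (by simpa [Gen.parity, indexParity, X₁₁] using hg (.a (.inl i) (.inl j))) ?_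
  rw [Matrix.mul_apply]
  refine Submodule.sum_mem _ fun l _ => mul_mem_zero (i := 1) (j := 1) rfl ?_ ?_
  · rw [Matrix.mul_apply]
    refine Submodule.sum_mem _ fun l' _ => ?_
    have h := SetLike.GradedMul.mul_mem (hg (.a (.inl i) (.inr l'))) (hS l' l)
    simpa [Gen.parity, indexParity, Ξ₁₂] using h
  · simpa [Gen.parity, indexParity, Ξ₂₁] using hg (.a (.inr l) (.inl j))

end Homogeneous

/-! ### The superalgebras `k[GL(m|n)]` and `k[SL(m|n)]` -/

section Algebras

/-- The defining relations of `k[GL(m|n)]`: the generators supercommute, odd generators have square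
zero (a consequence of supercommutativity unless `2` fails to be invertible), and `dinv₁`, `dinv₂`
are inverse to `det X₁₁`, `det X₂₂`. -/
inductive GLRel (k : Type*) [CommRing k] (m n : ℕ) :
    FreeAlgebra k (Gen m n) → FreeAlgebra k (Gen m n) → Prop
  | comm (x y : Gen m n) : GLRel k m n (FreeAlgebra.ι k x * FreeAlgebra.ι k y)
      ((-1 : ℤˣ) ^ (x.parity * y.parity) • (FreeAlgebra.ι k y * FreeAlgebra.ι k x))
  | sq (x : Gen m n) (hx : x.parity = 1) :
      GLRel k m n (FreeAlgebra.ι k x * FreeAlgebra.ι k x) 0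
  | inv₁ : GLRel k m n (FreeAlgebra.ι k .dinv₁ * det (X₁₁ (FreeAlgebra.ι k))) 1
  | inv₂ : GLRel k m n (FreeAlgebra.ι k .dinv₂ * det (X₂₂ (FreeAlgebra.ι k))) 1

variable (k : Type*) [CommRing k] (m n : ℕ)

/-- The superalgebra `k[GL(m|n)]`. -/
def GLAlg : Type _ := RingQuot (GLRel k m n)

instance : Ring (GLAlg k m n) := inferInstanceAs (Ring (RingQuot (GLRel k m n)))

instance : Algebra k (GLAlg k m n) := inferInstanceAs (Algebra k (RingQuot (GLRel k m n)))

/-- The generators of `k[GL(m|n)]`. -/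
def GLAlg.gen (x : Gen m n) : GLAlg k m n :=
  RingQuot.mkAlgHom k (GLRel k m n) (FreeAlgebra.ι k x)

/-- The even and odd parts of `k[GL(m|n)]`. -/
def GLAlg.part : ZMod 2 → Submodule k (GLAlg k m n) :=
  quotPart (freePart k Gen.parity) (GLRel k m n)

instance : GradedAlgebra (GLAlg.part k m n) :=
  quotPart.gradedAlgebra (freePart k Gen.parity) (GLRel k m n) (by
    have hι : ∀ x : Gen m n, FreeAlgebra.ι k x ∈ freePart k Gen.parity x.parity :=
      fun x => ι_mem_freePart _ x
    intro a b h
    cases h with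
    | comm x y =>
      refine ⟨x.parity + y.parity, SetLike.GradedMul.mul_mem (hι x) (hι y), ?_⟩
      have h := SetLike.GradedMul.mul_mem (hι y) (hι x)
      rw [add_comm] at h
      rcases Int.units_eq_one_or ((-1 : ℤˣ) ^ (x.parity * y.parity)) with hs | hs <;> rw [hs]
      · simpa using h
      · simpa using h
    | sq x hx =>
      exact ⟨_, SetLike.GradedMul.mul_mem (hι x) (hι x), Submodule.zero_mem _⟩
    | inv₁ =>
      exact ⟨0, mul_mem_zero (add_zero 0) (hι .dinv₁)
        (det_mem fun i j => hι (.a (.inl i) (.inl j))), SetLike.GradedOne.one_mem⟩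
    | inv₂ =>
      exact ⟨0, mul_mem_zero (add_zero 0) (hι .dinv₂)
        (det_mem fun i j => hι (.a (.inr i) (.inr j))), SetLike.GradedOne.one_mem⟩)

theorem GLAlg.gen_mem (x : Gen m n) : GLAlg.gen k m n x ∈ GLAlg.part k m n x.parity :=
  mk_mem_quotPart _ (ι_mem_freePart _ x)

/-- The defining relation of `k[SL(m|n)]` as a quotient of `k[GL(m|n)]`. -/
inductive SLRel : GLAlg k m n → GLAlg k m n → Prop
  | ber_eq_one : SLRel (ber (GLAlg.gen k m n)) 1

/-- The superalgebra `k[SL(m|n)]`, the quotient of `k[GL(m|n)]` by the ideal generated by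
`Ber - 1`. -/
def SLAlg : Type _ := RingQuot (SLRel k m n)

instance : Ring (SLAlg k m n) := inferInstanceAs (Ring (RingQuot (SLRel k m n)))

instance : Algebra k (SLAlg k m n) := inferInstanceAs (Algebra k (RingQuot (SLRel k m n)))

/-- The generators of `k[SL(m|n)]`. -/
def SLAlg.gen (x : Gen m n) : SLAlg k m n :=
  RingQuot.mkAlgHom k (SLRel k m n) (GLAlg.gen k m n x)

/-- The even and odd parts of `k[SL(m|n)]`. -/
def SLAlg.part : ZMod 2 → Submodule k (SLAlg k m n) :=
  quotPart (GLAlg.part k m n) (SLRel k m n)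

instance : GradedAlgebra (SLAlg.part k m n) :=
  quotPart.gradedAlgebra (GLAlg.part k m n) (SLRel k m n) (by
    rintro _ _ ⟨⟩
    exact ⟨0, ber_mem (GLAlg.gen_mem k m n), SetLike.GradedOne.one_mem⟩)

end Algebras

/-! ### The explicit formulas -/

section Formulas

variable {k A : Type*} [CommRing k] [Ring A] [Algebra k A]

/-- The alternating sum
`∑_{i=1}^{2mn+2} (-1)^{i-1} (e^i ⊗ e^i) (Δ(d) - d ⊗ d)^{i-1}`. -/
def invDetComul {𝒜 : ZMod 2 → Submodule k A} [GradedAlgebra 𝒜] (S : SuperBialgebra 𝒜)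
    (m n : ℕ) (e d : A) : 𝒜 ᵍ⊗[k] 𝒜 :=
  ∑ i ∈ Finset.Icc 1 (2 * m * n + 2),
    (-1) ^ (i - 1) * ((e ^ i) ᵍ⊗ₜ[k] (e ^ i)) * (S.Δ d - (d ᵍ⊗ₜ[k] d)) ^ (i - 1)

/-- The comultiplication and the counit are given by the standard formulas on the generators
`g`. -/
structure HasStandardFormulas {𝒜 : ZMod 2 → Submodule k A} [GradedAlgebra 𝒜]
    (S : SuperBialgebra 𝒜) {m n : ℕ} (g : Gen m n → A) : Prop where
  comul_a : ∀ i j, S.Δ (g (.a i j)) = ∑ l, (g (.a i l) ᵍ⊗ₜ[k] g (.a l j))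
  comul_dinv₁ : S.Δ (g .dinv₁) = invDetComul S m n (g .dinv₁) (det (X₁₁ g))
  comul_dinv₂ : S.Δ (g .dinv₂) = invDetComul S m n (g .dinv₂) (det (X₂₂ g))
  counit_a : ∀ i j, S.ε (g (.a i j)) = if i = j then 1 else 0
  counit_dinv₁ : S.ε (g .dinv₁) = 1
  counit_dinv₂ : S.ε (g .dinv₂) = 1

end Formulas

end SuperGroup

end

/-!
The superalgebra `k[GL(m|n)]` has a universal property: a morphism to a superalgebra `C` is a
supermatrix over `C` whose diagonal blocks have determinants with prescribed inverses, provided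
that the entries supercommute and the odd ones have square zero. The argument consists in applying
it to the matrix `(∑_l a i l ⊗ a l j)` over `A ⊗ A`, the product of the supermatrices `(a i j ⊗ 1)`
and `(1 ⊗ a i j)`. All superalgebras involved are strictly supercommutative (odd elements have
square zero, in any characteristic), and this is inherited by tensor products. Their even parts are
commutative rings, so that the usual theory of determinants applies to even blocks.

*Inverses of determinants.* A diagonal block of a product of supermatrices is `P P' + E F` with
`P`, `P'` even and `E`, `F` odd of inner size `n` or `m`. Modulo the ideal of the elements
`∑ ξ_s b_s`, where `ξ` runs over the `m n` entries of `E` and the `b_s` are odd, its determinant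
is `det P det P'`. Each `ξ_s b_s` is even of square zero, so elements of this ideal are nilpotent
(`pow_eq_zero_of_mem_oddIdeal`). Hence `Δ(d) - d ⊗ d` is nilpotent, and the alternating sum is the
geometric series for the inverse of `Δ(d)` (`IsStandard.comulGen_inv₁`,
`IsStandard.comulGen_inv₂`).

*The Berezinian.* A supermatrix with invertible lower diagonal block has a unique Gauss
decomposition `(1 X; 0 1) (A 0; 0 D) (1 0; Y 1)`, and its Berezinian is `det A det D⁻¹`.
Multiplication from the left by upper unipotent or block diagonal matrices is harmless. The lower
unipotent matrices form an additive group generated by those with a single nonzero entry `y`; for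
these `Y X Y = 0` because `y x y = - y y x = 0`, and the factor by which the Berezinian changes is
`(1 + y x) (1 - y x) = 1` (`HasBerezinian.lower_single_mul`). This proves multiplicativity
(`ber_mul`) in every characteristic, without a logarithm of the determinant. So the Berezinian is
grouplike, and `Δ` and `ε` descend to `k[SL(m|n)]`.

*The coalgebra laws.* Both sides of each law are morphisms of superalgebras; for coassociativity
this uses that `A ⊗ A` with the total parity is again a superalgebra. A morphism is determined by
the images of the `a i j` (`IsStandard.algHom_ext`), on which the laws are immediate.
-/


open scoped TensorProduct DirectSum

noncomputable section

namespace SuperGroup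

/-! ### Strictly supercommutative superalgebras -/

section Strict

variable {k B : Type*} [CommRing k] [Ring B] [Algebra k B]

/-- A superalgebra is strictly supercommutative if it is supercommutative and its odd elements have
square zero; the second condition follows from the first if `2` is invertible. -/
class StrictlySupercommutative (ℬ : ZMod 2 → Submodule k B) : Prop where
  comm : IsSupercommutative ℬ
  sq : ∀ x ∈ ℬ 1, x * x = 0

theorem parity_eq_zero_or_one (i : ZMod 2) : i = 0 ∨ i = 1 := by
  revert i
  decide

theorem isSupercommutative_iff {ℬ : ZMod 2 → Submodule k B} :
    IsSupercommutative ℬ ↔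
      (∀ i, ∀ x ∈ ℬ 0, ∀ y ∈ ℬ i, x * y = y * x) ∧
        ∀ x ∈ ℬ 1, ∀ y ∈ ℬ 1, x * y = -(y * x) := by
  constructor
  · intro h
    refine ⟨fun i x hx y hy => ?_, fun x hx y hy => ?_⟩
    · simpa using h 0 i x hx y hy
    · simpa using h 1 1 x hx y hy
  · rintro ⟨h₀, h₁⟩ i j x hx y hy
    rcases parity_eq_zero_or_one i with rfl | rfl
    · simpa using h₀ _ x hx y hy
    · rcases parity_eq_zero_or_one j with rfl | rfl
      · simpa using (h₀ _ y hy x hx).symm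
      · simpa using h₁ x hx y hy

variable {ℬ : ZMod 2 → Submodule k B}

section

variable [StrictlySupercommutative ℬ]

theorem even_comm {i : ZMod 2} {x y : B} (hx : x ∈ ℬ 0) (hy : y ∈ ℬ i) : x * y = y * x :=
  (isSupercommutative_iff.1 StrictlySupercommutative.comm).1 i x hx y hy

theorem odd_anticomm {x y : B} (hx : x ∈ ℬ 1) (hy : y ∈ ℬ 1) : x * y = -(y * x) :=
  (isSupercommutative_iff.1 StrictlySupercommutative.comm).2 x hx y hy

theorem odd_sq {x : B} (hx : x ∈ ℬ 1) : x * x = 0 := StrictlySupercommutative.sq x hx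

end

variable [SetLike.GradedMonoid ℬ]

theorem odd_mul_odd {x y : B} (hx : x ∈ ℬ 1) (hy : y ∈ ℬ 1) : x * y ∈ ℬ 0 :=
  mul_mem_zero (i := 1) (j := 1) rfl hx hy

theorem even_mul {i : ZMod 2} {x y : B} (hx : x ∈ ℬ 0) (hy : y ∈ ℬ i) : x * y ∈ ℬ i := by
  simpa using SetLike.GradedMul.mul_mem hx hy

theorem mul_even {i : ZMod 2} {x y : B} (hx : x ∈ ℬ i) (hy : y ∈ ℬ 0) : x * y ∈ ℬ i := by
  simpa using SetLike.GradedMul.mul_mem hx hy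

/-- The even part of a supercommutative superalgebra is a commutative ring. -/
instance evenCommRing [StrictlySupercommutative ℬ] : CommRing (ℬ 0) :=
  { SetLike.GradeZero.instRing ℬ with
    mul_comm := fun x y => Subtype.ext (even_comm x.2 y.2) }

variable (ℬ) in
/-- The inclusion of the even part. -/
def evenVal : ℬ 0 →+* B where
  toFun x := x
  map_one' := rfl
  map_mul' _ _ := rfl
  map_zero' := rfl
  map_add' _ _ := rfl

@[simp]
theorem evenVal_apply (x : ℬ 0) : evenVal ℬ x = x := rfl

theorem evenVal_injective : Function.Injective (evenVal ℬ) := Subtype.val_injective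

end Strict

/-! ### Determinants of matrices with even entries -/

section Det

theorem map_det {B B' : Type*} [Ring B] [Ring B'] (f : B →+* B') {r : ℕ}
    (M : Matrix (Fin r) (Fin r) B) : f (det M) = det (M.map f) := by
  simp only [det, map_sum, Units.smul_def, map_zsmul, map_list_prod, List.map_ofFn]
  rfl

theorem map_minor {B B' : Type*} [Ring B] [Ring B'] (f : B →+* B') {r : ℕ}
    (M : Matrix (Fin r) (Fin r) B) (i j : Fin r) : f (minor M i j) = minor (M.map f) i j := by
  cases r with
  | zero => exact i.elim0
  | succ r => exact map_det f _

theorem map_cramerInv {B B' : Type*} [Ring B] [Ring B'] (f : B →+* B') {r : ℕ}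
    (M : Matrix (Fin r) (Fin r) B) (e : B) :
    (cramerInv M e).map f = cramerInv (M.map f) (f e) := by
  ext i j
  simp [cramerInv, map_minor]

/-- Over a commutative ring, `det` is the usual determinant. -/
theorem det_eq_matrix_det {C : Type*} [CommRing C] {r : ℕ} (M : Matrix (Fin r) (Fin r) C) :
    det M = M.det := by
  rw [← Matrix.det_transpose, Matrix.det_apply]
  simp [det, List.prod_ofFn]

theorem cramerInv_eq_smul_adjugate {C : Type*} [CommRing C] {r : ℕ}
    (M : Matrix (Fin r) (Fin r) C) (e : C) : cramerInv M e = e • M.adjugate := by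
  ext i j
  cases r with
  | zero => exact i.elim0
  | succ r =>
    simp only [cramerInv, minor, Matrix.of_apply, Matrix.smul_apply, smul_eq_mul,
      Matrix.adjugate_fin_succ_eq_det_submatrix, det_eq_matrix_det]
    rw [add_comm (i : ℕ)]
    ring

theorem cramerInv_mul {C : Type*} [CommRing C] {r : ℕ} {M : Matrix (Fin r) (Fin r) C} {e : C}
    (he : e * M.det = 1) : cramerInv M e * M = 1 := by
  rw [cramerInv_eq_smul_adjugate, Matrix.smul_mul, Matrix.adjugate_mul, smul_smul, he, one_smul]

variable {B B' : Type*} [Ring B] [Ring B'] {m n : ℕ}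

theorem map_ber (f : B →+* B') (g : Gen m n → B) : f (ber g) = ber (f ∘ g) := by
  have hS : (S₂₂ g).map f = S₂₂ (f ∘ g) := map_cramerInv f _ _
  have h : (X₁₁ g - Ξ₁₂ g * S₂₂ g * Ξ₂₁ g).map f =
      X₁₁ (f ∘ g) - Ξ₁₂ (f ∘ g) * S₂₂ (f ∘ g) * Ξ₂₁ (f ∘ g) := by
    rw [Matrix.map_sub _ (map_sub f), Matrix.map_mul, Matrix.map_mul, hS]
    rfl
  rw [ber, ber, map_mul, map_det, map_det, hS, h]

end Det

/-! ### The determinant of a product of supermatrices, up to nilpotents -/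

section Nilpotent

variable {k B : Type*} [CommRing k] [Ring B] [Algebra k B]
variable {ℬ : ZMod 2 → Submodule k B} [SetLike.GradedMonoid ℬ]

theorem exists_even_matrix {p q : Type*} {M : Matrix p q B} (hM : ∀ i j, M i j ∈ ℬ 0) :
    ∃ M' : Matrix p q (ℬ 0), M'.map (evenVal ℬ) = M :=
  ⟨Matrix.of fun i j => ⟨M i j, hM i j⟩, rfl⟩

variable [StrictlySupercommutative ℬ]

theorem det_map_evenVal {r : ℕ} (M : Matrix (Fin r) (Fin r) (ℬ 0)) :
    det (M.map (evenVal ℬ)) = evenVal ℬ M.det := by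
  rw [← map_det, det_eq_matrix_det]

/-- The ideal of the even part consisting of the elements `∑ ξ_s b_s` with odd `b_s`, for a given
family `ξ` of odd elements. -/
def oddIdeal {σ : Type*} [Fintype σ] (ξ : σ → ℬ 1) : Ideal (ℬ 0) where
  carrier := {z | ∃ b : σ → ℬ 1, (z : B) = ∑ s, (ξ s : B) * b s}
  zero_mem' := ⟨0, by simp⟩
  add_mem' := by
    rintro _ _ ⟨b, hb⟩ ⟨b', hb'⟩
    exact ⟨b + b', by simp [hb, hb', mul_add, Finset.sum_add_distrib]⟩
  smul_mem' := by
    rintro c z ⟨b, hb⟩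
    refine ⟨fun s => ⟨c * b s, even_mul c.2 (b s).2⟩, ?_⟩
    change (c : B) * z = _
    rw [hb, Finset.mul_sum]
    refine Finset.sum_congr rfl fun s _ => ?_
    rw [← mul_assoc, even_comm c.2 (ξ s).2, mul_assoc]

/-- An element `∑ ξ_s b_s` is a sum of commuting elements of square zero. -/
theorem pow_eq_zero_of_mem_oddIdeal {σ : Type*} [Fintype σ] {ξ : σ → ℬ 1} {z : ℬ 0}
    (hz : z ∈ oddIdeal ξ) : z ^ (Fintype.card σ + 1) = 0 := by
  classical
  obtain ⟨b, hb⟩ := hz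
  let w (s : σ) : ℬ 0 := ⟨ξ s * b s, odd_mul_odd (ξ s).2 (b s).2⟩
  have hw (s : σ) : w s ^ 2 = 0 := by
    rw [sq]
    refine Subtype.ext ?_
    change (ξ s * b s : B) * (ξ s * b s) = 0
    rw [mul_assoc, ← mul_assoc (b s : B), odd_anticomm (b s).2 (ξ s).2, neg_mul, mul_neg,
      ← mul_assoc, ← mul_assoc, odd_sq (ξ s).2, zero_mul, zero_mul, neg_zero]
  have hz : z = ∑ s, w s := evenVal_injective (by rw [map_sum]; exact hb)
  have key (t : Finset σ) : (∑ s ∈ t, w s) ^ (t.card + 1) = 0 := by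
    induction t using Finset.induction_on with
    | empty => simp
    | insert s t hs ih =>
      rw [Finset.sum_insert hs, Finset.card_insert_of_notMem hs]
      exact (Commute.all _ _).add_pow_eq_zero_of_add_le_succ_of_pow_eq_zero (hw s) ih (by omega)
  rw [hz]
  exact key Finset.univ

theorem det_add_sub_det_mem {C : Type*} [CommRing C] {r : Type*} [Fintype r] [DecidableEq r]
    (J : Ideal C) (P Q : Matrix r r C) (hQ : ∀ i j, Q i j ∈ J) : (P + Q).det - P.det ∈ J := by
  rw [← Ideal.Quotient.eq, RingHom.map_det, RingHom.map_det]
  congr 1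
  ext i j
  simpa [Ideal.Quotient.eq_zero_iff_mem] using hQ i j

/-- If `Q = P P' + E F` with `P`, `P'` even and `E`, `F` odd, then `det Q - det P det P'` lies in
the ideal attached to the `r s` entries of `E`, hence is nilpotent. -/
theorem det_sub_mul_det_pow_eq_zero {r s : ℕ} {P P' Q : Matrix (Fin r) (Fin r) B}
    {E : Matrix (Fin r) (Fin s) B} {F : Matrix (Fin s) (Fin r) B}
    (hP : ∀ i j, P i j ∈ ℬ 0) (hP' : ∀ i j, P' i j ∈ ℬ 0)
    (hE : ∀ i j, E i j ∈ ℬ 1) (hF : ∀ i j, F i j ∈ ℬ 1) (hQ : Q = P * P' + E * F) :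
    (det Q - det P * det P') ^ (r * s + 1) = 0 := by
  obtain ⟨P, rfl⟩ := exists_even_matrix hP
  obtain ⟨P', rfl⟩ := exists_even_matrix hP'
  have hEF : ∀ i j, (E * F) i j ∈ ℬ 0 := fun i j => by
    rw [Matrix.mul_apply]
    exact Submodule.sum_mem _ fun l _ => odd_mul_odd (hE i l) (hF l j)
  obtain ⟨G, hG⟩ := exists_even_matrix hEF
  have hmem := det_add_sub_det_mem
    (oddIdeal fun s : Fin r × Fin s => (⟨E s.1 s.2, hE s.1 s.2⟩ : ℬ 1)) (P * P') G (by
      intro i j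
      refine ⟨fun s => if s.1 = i then ⟨F s.2 j, hF s.2 j⟩ else 0, ?_⟩
      have h := congrFun (congrFun hG i) j
      rw [Matrix.mul_apply] at h
      rw [Fintype.sum_prod_type, Finset.sum_eq_single i]
      · simpa using h
      · intro b _ hb
        simp [hb]
      · simp)
  have h := congrArg (evenVal ℬ) (pow_eq_zero_of_mem_oddIdeal hmem)
  rw [Matrix.det_mul, map_pow, map_sub, map_mul, ← det_map_evenVal, ← det_map_evenVal,
    ← det_map_evenVal, Matrix.map_add _ (map_add _), Matrix.map_mul, hG, map_zero] at h
  rw [hQ]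
  simpa using h

end Nilpotent

/-! ### Multiplicativity of the Berezinian -/

section Berezinian

variable {k B : Type*} [CommRing k] [Ring B] [Algebra k B]
variable {ℬ : ZMod 2 → Submodule k B} [SetLike.GradedMonoid ℬ]

theorem odd_mul_map_evenVal {p q r : Type*} [Fintype q] {X : Matrix p q B}
    (hX : ∀ i j, X i j ∈ ℬ 1) (D : Matrix q r (ℬ 0)) (i : p) (j : r) :
    (X * D.map (evenVal ℬ)) i j ∈ ℬ 1 := by
  rw [Matrix.mul_apply]
  exact Submodule.sum_mem _ fun l _ => mul_even (hX i l) (D l j).2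

theorem map_evenVal_mul_odd {p q r : Type*} [Fintype q] {X : Matrix q r B}
    (hX : ∀ i j, X i j ∈ ℬ 1) (D : Matrix p q (ℬ 0)) (i : p) (j : r) :
    (D.map (evenVal ℬ) * X) i j ∈ ℬ 1 := by
  rw [Matrix.mul_apply]
  exact Submodule.sum_mem _ fun l _ => even_mul (D i l).2 (hX l j)

variable [StrictlySupercommutative ℬ]
variable {p q : Type*} [Fintype p] [DecidableEq p] [Fintype q] [DecidableEq q]

/-- `HasBerezinian ℬ M b` says that the supermatrix `M` has the Gauss decomposition
`(1 X; 0 1) (A 0; 0 D) (1 0; Y 1)` with odd `X`, `Y` and even `A`, `D`, where `D` is invertible,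
and that `b = det A · det D⁻¹`. -/
def HasBerezinian (ℬ : ZMod 2 → Submodule k B) [SetLike.GradedMonoid ℬ]
    [StrictlySupercommutative ℬ] (M : Matrix (p ⊕ q) (p ⊕ q) B) (b : ℬ 0) : Prop :=
  ∃ (A : Matrix p p (ℬ 0)) (D E : Matrix q q (ℬ 0)) (X : Matrix p q B) (Y : Matrix q p B),
    (∀ i j, X i j ∈ ℬ 1) ∧ (∀ i j, Y i j ∈ ℬ 1) ∧ D * E = 1 ∧ b = A.det * E.det ∧
    M = Matrix.fromBlocks
      (A.map (evenVal ℬ) + X * D.map (evenVal ℬ) * Y) (X * D.map (evenVal ℬ))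
      (D.map (evenVal ℬ) * Y) (D.map (evenVal ℬ))

theorem mul_cancel_left_of_eq_one {q r : Type*} [Fintype q] [DecidableEq q] {D E : Matrix q q B}
    (h : D * E = 1) (Z : Matrix q r B) : D * (E * Z) = Z := by
  rw [← Matrix.mul_assoc, h, Matrix.one_mul]

theorem map_evenVal_mul_eq_one {D E : Matrix q q (ℬ 0)} (h : D * E = 1) :
    D.map (evenVal ℬ) * E.map (evenVal ℬ) = 1 := by
  rw [← Matrix.map_mul, h, Matrix.map_one _ (map_zero _) (map_one _)]

/-- The factors of the Gauss decomposition can be read off from the blocks of `M`. -/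
theorem HasBerezinian.unique {M : Matrix (p ⊕ q) (p ⊕ q) B} {b b' : ℬ 0}
    (h : HasBerezinian ℬ M b) (h' : HasBerezinian ℬ M b') : b = b' := by
  obtain ⟨A, D, E, X, Y, -, -, hDE, rfl, rfl⟩ := h
  obtain ⟨A', D', E', X', Y', -, -, hDE', rfl, h⟩ := h'
  obtain ⟨hA, hX, hY, hD⟩ := Matrix.fromBlocks_inj.1 h
  obtain rfl : D = D' := Matrix.map_injective evenVal_injective hD
  have hX : X = X' := by
    have := congrArg (· * E.map (evenVal ℬ)) hX
    simpa [Matrix.mul_assoc, map_evenVal_mul_eq_one hDE] using this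
  have hE : E = E' := by
    rw [← Matrix.mul_one E, ← hDE', ← Matrix.mul_assoc, mul_eq_one_comm.1 hDE,
      Matrix.one_mul]
  rw [Matrix.mul_assoc, Matrix.mul_assoc, hY, hX, add_left_inj] at hA
  rw [Matrix.map_injective evenVal_injective hA, hE]

theorem HasBerezinian.upper_mul {M : Matrix (p ⊕ q) (p ⊕ q) B} {b : ℬ 0}
    (h : HasBerezinian ℬ M b) {X' : Matrix p q B} (hX' : ∀ i j, X' i j ∈ ℬ 1) :
    HasBerezinian ℬ (Matrix.fromBlocks 1 X' 0 1 * M) b := by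
  obtain ⟨A, D, E, X, Y, hX, hY, hDE, rfl, rfl⟩ := h
  refine ⟨A, D, E, X + X', Y, fun i j => add_mem (hX i j) (hX' i j), hY, hDE, rfl, ?_⟩
  rw [Matrix.fromBlocks_multiply]
  congr 1 <;> simp [Matrix.add_mul, Matrix.mul_assoc, add_assoc]

theorem HasBerezinian.diagonal_mul {M : Matrix (p ⊕ q) (p ⊕ q) B} {b : ℬ 0}
    (h : HasBerezinian ℬ M b) (A' : Matrix p p (ℬ 0)) {D' E' : Matrix q q (ℬ 0)}
    (hDE' : D' * E' = 1) :
    HasBerezinian ℬ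
      (Matrix.fromBlocks (A'.map (evenVal ℬ)) 0 0 (D'.map (evenVal ℬ)) * M)
      (A'.det * E'.det * b) := by
  obtain ⟨A, D, E, X, Y, hX, hY, hDE, rfl, rfl⟩ := h
  refine ⟨A' * A, D' * D, E * E', A'.map (evenVal ℬ) * X * E'.map (evenVal ℬ), Y,
    odd_mul_map_evenVal (map_evenVal_mul_odd hX A') E', hY, ?_, ?_, ?_⟩
  · rw [Matrix.mul_assoc, ← Matrix.mul_assoc D, hDE, Matrix.one_mul, hDE']
  · rw [Matrix.det_mul, Matrix.det_mul]
    ring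
  · have hE := map_evenVal_mul_eq_one (mul_eq_one_comm.1 hDE')
    rw [Matrix.fromBlocks_multiply]
    congr 1 <;> simp [Matrix.map_mul, Matrix.mul_assoc, Matrix.mul_add,
      mul_cancel_left_of_eq_one hE]

/-- If `Y = y E_{ij}` with `y` odd then `Y X Y = 0`, since `y x y = - y y x`; hence
`(1 + Y X)⁻¹ = 1 - Y X`, and the Gauss decomposition of `(1 0; Y 1) M` is explicit. -/
theorem HasBerezinian.lower_single_mul {M : Matrix (p ⊕ q) (p ⊕ q) B} {b : ℬ 0}
    (h : HasBerezinian ℬ M b) (i : q) (j : p) {y : B} (hy : y ∈ ℬ 1) :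
    HasBerezinian ℬ (Matrix.fromBlocks 1 0 (Matrix.single i j y) 1 * M) b := by
  obtain ⟨A, D, E, X, Y, hX, hY, hDE, rfl, rfl⟩ := h
  set S : Matrix q p B := Matrix.single i j y with hS
  let u : p → q → ℬ 0 := fun a c => ⟨y * X a c, odd_mul_odd hy (hX a c)⟩
  -- `V` and `W` are the rank one matrices `S X` and `- X S`, with entries in the even part
  let V : Matrix q q (ℬ 0) := Matrix.vecMulVec (Pi.single i 1) (u j)
  let W : Matrix p p (ℬ 0) := Matrix.vecMulVec (fun a => u a i) (Pi.single j 1)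
  have huu : u j i * u j i = 0 := by
    refine Subtype.ext ?_
    change y * X j i * (y * X j i) = 0
    rw [mul_assoc, ← mul_assoc (X j i), odd_anticomm (hX j i) hy, neg_mul, mul_neg, ← mul_assoc,
      ← mul_assoc, odd_sq hy, zero_mul, zero_mul, neg_zero]
  have hSXS : S * X * S = 0 := by
    rw [hS, Matrix.single_mul_mul_single, mul_assoc, odd_anticomm (hX j i) hy, mul_neg, ← mul_assoc,
      odd_sq hy, zero_mul, neg_zero, Matrix.single_zero]
  have hV : V.map (evenVal ℬ) = S * X := by
    ext a c
    by_cases ha : a = i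
    · subst ha
      simp [V, u, hS, Matrix.vecMulVec_apply]
    · simp [V, hS, Matrix.vecMulVec_apply, Matrix.single_mul_apply_of_ne, ha]
  have hW : W.map (evenVal ℬ) = -(X * S) := by
    ext a c
    by_cases hc : c = j
    · subst hc
      simp [W, u, hS, Matrix.vecMulVec_apply, odd_anticomm hy (hX a i)]
    · simp [W, hS, Matrix.vecMulVec_apply, Matrix.mul_single_apply_of_ne, hc]
  have hdetV : (1 - V).det = 1 - u j i := by
    simp only [V]
    rw [Matrix.vecMulVec_eq Unit, Matrix.det_one_sub_mul_comm]
    simp [Matrix.mul_apply, Pi.single_apply]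
  have hdetW : (1 + W).det = 1 + u j i := by
    simp only [W]
    rw [Matrix.vecMulVec_eq Unit, Matrix.det_one_add_mul_comm]
    simp [Matrix.mul_apply, Pi.single_apply]
  have hVV : V * V = 0 := by
    refine Matrix.map_injective evenVal_injective ?_
    dsimp only
    rw [Matrix.map_mul, hV, ← Matrix.mul_assoc, hSXS, Matrix.zero_mul,
      Matrix.map_zero _ (map_zero _)]
  have hDE₁ : D.map (evenVal ℬ) * E.map (evenVal ℬ) = 1 := map_evenVal_mul_eq_one hDE
  -- the new blocks are `(1 - X S) A` and `(1 + S X) D`, and `(1 + S X)⁻¹ = 1 - S X`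
  refine ⟨(1 + W) * A, (1 + V) * D, E * (1 - V), X - X * (S * X),
    E.map (evenVal ℬ) * (S * A.map (evenVal ℬ)) + Y, ?_, ?_, ?_, ?_, ?_⟩
  · intro a c
    rw [← hV]
    exact sub_mem (hX a c) (odd_mul_map_evenVal hX V a c)
  · intro a c
    have hSodd : ∀ a c, S a c ∈ ℬ 1 := fun a c => by
      rw [hS, Matrix.single_apply]
      split_ifs
      exacts [hy, zero_mem _]
    exact add_mem (map_evenVal_mul_odd (odd_mul_map_evenVal hSodd A) E a c) (hY a c)
  · rw [Matrix.mul_assoc, ← Matrix.mul_assoc D, hDE, Matrix.one_mul, Matrix.add_mul,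
      Matrix.mul_sub, Matrix.mul_sub, hVV]
    simp
  · -- the two new factors of the Berezinian multiply to `(1 + u) (1 - u) = 1 - u² = 1`
    rw [Matrix.det_mul, Matrix.det_mul, hdetV, hdetW]
    linear_combination (A.det * E.det) * huu
  · have hD : ((1 + V) * D).map (evenVal ℬ) = (1 + S * X) * D.map (evenVal ℬ) := by
      rw [Matrix.map_mul, Matrix.map_add _ (map_add _), hV,
        Matrix.map_one _ (map_zero _) (map_one _)]
    have hA : ((1 + W) * A).map (evenVal ℬ) = (1 - X * S) * A.map (evenVal ℬ) := by
      rw [Matrix.map_mul, Matrix.map_add _ (map_add _), hW,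
        Matrix.map_one _ (map_zero _) (map_one _), sub_eq_add_neg]
    have hXD : (X - X * (S * X)) * ((1 + S * X) * D.map (evenVal ℬ)) = X * D.map (evenVal ℬ) := by
      have : (X - X * (S * X)) * (1 + S * X) = X := by
        have h0 : X * (S * X) * (S * X) = 0 := by
          rw [Matrix.mul_assoc, ← Matrix.mul_assoc (S * X), hSXS, Matrix.zero_mul, Matrix.mul_zero]
        rw [Matrix.mul_add, Matrix.sub_mul, Matrix.sub_mul, h0]
        simp
      rw [← Matrix.mul_assoc, this]
    have hDY : (1 + S * X) * D.map (evenVal ℬ) * (E.map (evenVal ℬ) * (S * A.map (evenVal ℬ)) + Y) =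
        S * A.map (evenVal ℬ) + (1 + S * X) * (D.map (evenVal ℬ) * Y) := by
      rw [Matrix.mul_assoc, Matrix.mul_add, mul_cancel_left_of_eq_one hDE₁, Matrix.mul_add,
        Matrix.add_mul, ← Matrix.mul_assoc (S * X), hSXS]
      simp
    rw [Matrix.fromBlocks_multiply, hD, hA, hXD, hDY, Matrix.mul_assoc X _ (_ + Y),
      Matrix.mul_add (D.map _), mul_cancel_left_of_eq_one hDE₁]
    congr 1
    · simp only [Matrix.mul_assoc, Matrix.sub_mul, Matrix.mul_add, Matrix.one_mul, Matrix.zero_mul]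
      abel
    · simp
    · simp only [Matrix.mul_assoc, Matrix.add_mul, Matrix.mul_add, Matrix.one_mul]
      abel
    · simp [Matrix.mul_assoc, Matrix.add_mul, add_comm]

/-- The matrices `(1 0; Y 1)` multiply by adding the blocks `Y`, so the case of a single nonzero
entry suffices. -/
theorem HasBerezinian.lower_mul {M : Matrix (p ⊕ q) (p ⊕ q) B} {b : ℬ 0}
    (h : HasBerezinian ℬ M b) {Y' : Matrix q p B} (hY' : ∀ i j, Y' i j ∈ ℬ 1) :
    HasBerezinian ℬ (Matrix.fromBlocks 1 0 Y' 1 * M) b := by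
  let P (Y' : Matrix q p B) : Prop := ∀ M : Matrix (p ⊕ q) (p ⊕ q) B,
    HasBerezinian ℬ M b → HasBerezinian ℬ (Matrix.fromBlocks 1 0 Y' 1 * M) b
  have hadd (Y₁ Y₂ : Matrix q p B) (h₁ : P Y₁) (h₂ : P Y₂) : P (Y₁ + Y₂) := fun M hM => by
    have := h₁ _ (h₂ M hM)
    rw [← Matrix.mul_assoc, Matrix.fromBlocks_multiply] at this
    simpa using this
  have hzero : P 0 := fun M hM => by rwa [Matrix.fromBlocks_one, Matrix.one_mul]
  suffices P Y' from this M h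
  rw [Matrix.matrix_eq_sum_single Y']
  refine Finset.sum_induction _ P hadd hzero fun i _ => ?_
  exact Finset.sum_induction _ P hadd hzero fun j _ M hM => hM.lower_single_mul i j (hY' i j)

theorem HasBerezinian.mul {M M' : Matrix (p ⊕ q) (p ⊕ q) B} {b b' : ℬ 0}
    (h : HasBerezinian ℬ M b) (h' : HasBerezinian ℬ M' b') :
    HasBerezinian ℬ (M * M') (b * b') := by
  obtain ⟨A, D, E, X, Y, hX, hY, hDE, rfl, rfl⟩ := h
  have := ((h'.lower_mul hY).diagonal_mul A hDE).upper_mul hX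
  rw [← Matrix.mul_assoc, ← Matrix.mul_assoc, Matrix.fromBlocks_multiply,
    Matrix.fromBlocks_multiply] at this
  simpa using this

end Berezinian

section Generic

variable {B : Type*} {m n : ℕ}

/-- The supermatrix `(a i j)`. -/
def superMatrix (g : Gen m n → B) : Matrix (Fin m ⊕ Fin n) (Fin m ⊕ Fin n) B :=
  Matrix.of fun i j => g (.a i j)

theorem superMatrix_eq_fromBlocks (g : Gen m n → B) :
    superMatrix g = Matrix.fromBlocks (X₁₁ g) (Ξ₁₂ g) (Ξ₂₁ g) (X₂₂ g) := by
  ext (i | i) (j | j) <;> rfl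

variable {k : Type*} [CommRing k] [Ring B] [Algebra k B] {ℬ : ZMod 2 → Submodule k B}
variable {g : Gen m n → B}

theorem X₁₁_mem (hg : ∀ x, g x ∈ ℬ x.parity) (i j : Fin m) : X₁₁ g i j ∈ ℬ 0 :=
  hg (.a (.inl i) (.inl j))

theorem X₂₂_mem (hg : ∀ x, g x ∈ ℬ x.parity) (i j : Fin n) : X₂₂ g i j ∈ ℬ 0 :=
  hg (.a (.inr i) (.inr j))

theorem Ξ₁₂_mem (hg : ∀ x, g x ∈ ℬ x.parity) (i : Fin m) (j : Fin n) : Ξ₁₂ g i j ∈ ℬ 1 :=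
  hg (.a (.inl i) (.inr j))

theorem Ξ₂₁_mem (hg : ∀ x, g x ∈ ℬ x.parity) (i : Fin n) (j : Fin m) : Ξ₂₁ g i j ∈ ℬ 1 :=
  hg (.a (.inr i) (.inl j))

variable [SetLike.GradedMonoid ℬ] [StrictlySupercommutative ℬ]

/-- The Gauss decomposition `(1 Ξ₁₂S₂₂; 0 1) (X₁₁ - Ξ₁₂S₂₂Ξ₂₁ 0; 0 X₂₂) (1 0; S₂₂Ξ₂₁ 1)`. -/
theorem hasBerezinian_ber (hg : ∀ x, g x ∈ ℬ x.parity) (hd : g .dinv₂ * det (X₂₂ g) = 1) :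
    HasBerezinian ℬ (superMatrix g) ⟨ber g, ber_mem hg⟩ := by
  obtain ⟨D, hD⟩ := exists_even_matrix (X₂₂_mem hg)
  obtain ⟨e, he⟩ : ∃ e : ℬ 0, evenVal ℬ e = g .dinv₂ := ⟨⟨_, hg .dinv₂⟩, rfl⟩
  have hed : e * D.det = 1 := evenVal_injective (by
    rw [map_mul, ← det_map_evenVal, hD, he, hd, map_one])
  obtain ⟨E, hE⟩ : ∃ E : Matrix (Fin n) (Fin n) (ℬ 0), E.map (evenVal ℬ) = S₂₂ g ∧ D * E = 1 :=
    ⟨cramerInv D e, by rw [map_cramerInv, hD, he]; rfl, mul_eq_one_comm.1 (cramerInv_mul hed)⟩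
  obtain ⟨hE, hDE⟩ := hE
  have hDE₁ := map_evenVal_mul_eq_one hDE
  have hED₁ := map_evenVal_mul_eq_one (mul_eq_one_comm.1 hDE)
  rw [hD, hE] at hDE₁ hED₁
  have hA : ∀ i j, (X₁₁ g - Ξ₁₂ g * S₂₂ g * Ξ₂₁ g) i j ∈ ℬ 0 := fun i j => by
    refine sub_mem (X₁₁_mem hg i j) ?_
    rw [← hE, Matrix.mul_apply]
    exact sum_mem fun l _ => odd_mul_odd (odd_mul_map_evenVal (Ξ₁₂_mem hg) E i l) (Ξ₂₁_mem hg l j)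
  obtain ⟨A, hA⟩ := exists_even_matrix hA
  refine ⟨A, D, E, Ξ₁₂ g * S₂₂ g, S₂₂ g * Ξ₂₁ g, ?_, ?_, hDE, evenVal_injective ?_, ?_⟩
  · rw [← hE]
    exact odd_mul_map_evenVal (Ξ₁₂_mem hg) E
  · rw [← hE]
    exact map_evenVal_mul_odd (Ξ₂₁_mem hg) E
  · rw [mul_comm, map_mul, ← det_map_evenVal, ← det_map_evenVal, hA, hE]
    rfl
  · rw [superMatrix_eq_fromBlocks, hD, hA, Matrix.mul_assoc _ (S₂₂ g) (X₂₂ g), hED₁,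
      mul_cancel_left_of_eq_one hDE₁]
    simp [Matrix.mul_assoc]

/-- The Berezinian is multiplicative. -/
theorem ber_mul {g g' h : Gen m n → B} (hg : ∀ x, g x ∈ ℬ x.parity) (hg' : ∀ x, g' x ∈ ℬ x.parity)
    (hh : ∀ x, h x ∈ ℬ x.parity) (hd : g .dinv₂ * det (X₂₂ g) = 1)
    (hd' : g' .dinv₂ * det (X₂₂ g') = 1) (hdh : h .dinv₂ * det (X₂₂ h) = 1)
    (hmul : superMatrix h = superMatrix g * superMatrix g') : ber h = ber g * ber g' := by
  have h₁ := (hasBerezinian_ber hg hd).mul (hasBerezinian_ber hg' hd')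
  rw [← hmul] at h₁
  exact congrArg (evenVal ℬ) ((hasBerezinian_ber hh hdh).unique h₁)

theorem det_X₁₁_sub_pow_eq_zero {g g' h : Gen m n → B} (hg : ∀ x, g x ∈ ℬ x.parity)
    (hg' : ∀ x, g' x ∈ ℬ x.parity) (hmul : superMatrix h = superMatrix g * superMatrix g') :
    (det (X₁₁ h) - det (X₁₁ g) * det (X₁₁ g')) ^ (m * n + 1) = 0 := by
  simp only [superMatrix_eq_fromBlocks, Matrix.fromBlocks_multiply] at hmul
  exact det_sub_mul_det_pow_eq_zero (X₁₁_mem hg) (X₁₁_mem hg') (Ξ₁₂_mem hg) (Ξ₂₁_mem hg')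
    (Matrix.fromBlocks_inj.1 hmul).1

theorem det_X₂₂_sub_pow_eq_zero {g g' h : Gen m n → B} (hg : ∀ x, g x ∈ ℬ x.parity)
    (hg' : ∀ x, g' x ∈ ℬ x.parity) (hmul : superMatrix h = superMatrix g * superMatrix g') :
    (det (X₂₂ h) - det (X₂₂ g) * det (X₂₂ g')) ^ (n * m + 1) = 0 := by
  simp only [superMatrix_eq_fromBlocks, Matrix.fromBlocks_multiply] at hmul
  exact det_sub_mul_det_pow_eq_zero (X₂₂_mem hg) (X₂₂_mem hg') (Ξ₂₁_mem hg) (Ξ₁₂_mem hg')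
    ((Matrix.fromBlocks_inj.1 hmul).2.2.2.trans (add_comm _ _))

end Generic

/-! ### The tensor product of superalgebras as a superalgebra -/

section Tensor

variable {k A B : Type*} [CommRing k] [Ring A] [Algebra k A] [Ring B] [Algebra k B]
variable (𝒜 : ZMod 2 → Submodule k A) (ℬ : ZMod 2 → Submodule k B)
variable [GradedAlgebra 𝒜] [GradedAlgebra ℬ]

/-- The part of total parity `i` of the tensor product of two superalgebras. -/
def tensorPart (i : ZMod 2) : Submodule k (𝒜 ᵍ⊗[k] ℬ) :=
  Submodule.span k {x | ∃ j l, ∃ a ∈ 𝒜 j, ∃ b ∈ ℬ l, j + l = i ∧ x = a ᵍ⊗ₜ[k] b}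

variable {𝒜 ℬ}

theorem tmul_mem_tensorPart {i j l : ZMod 2} {a : A} {b : B} (ha : a ∈ 𝒜 j) (hb : b ∈ ℬ l)
    (h : j + l = i) : (a ᵍ⊗ₜ[k] b : 𝒜 ᵍ⊗[k] ℬ) ∈ tensorPart 𝒜 ℬ i :=
  Submodule.subset_span ⟨j, l, a, ha, b, hb, h, rfl⟩

theorem tmul_mul_tmul {j i : ZMod 2} (a : A) {b : B} (hb : b ∈ ℬ j) {a' : A} (ha' : a' ∈ 𝒜 i)
    (b' : B) : (a ᵍ⊗ₜ[k] b * a' ᵍ⊗ₜ[k] b' : 𝒜 ᵍ⊗[k] ℬ) =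
      (-1 : ℤˣ) ^ (j * i) • ((a * a') ᵍ⊗ₜ[k] (b * b')) :=
  GradedTensorProduct.tmul_coe_mul_coe_tmul 𝒜 ℬ a ⟨b, hb⟩ ⟨a', ha'⟩ b'

theorem intUnits_smul_mem {M : Type*} [AddCommGroup M] [Module k M] (N : Submodule k M) (u : ℤˣ)
    {x : M} (hx : x ∈ N) : u • x ∈ N := by
  rcases Int.units_eq_one_or u with rfl | rfl
  · simpa using hx
  · simpa using hx

instance tensorPart.gradedMonoid : SetLike.GradedMonoid (tensorPart 𝒜 ℬ) where
  one_mem := tmul_mem_tensorPart (SetLike.GradedOne.one_mem (A := 𝒜))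
    (SetLike.GradedOne.one_mem (A := ℬ)) (add_zero 0)
  mul_mem i i' x y hx hy := by
    have h : x * y ∈ tensorPart 𝒜 ℬ i * tensorPart 𝒜 ℬ i' := Submodule.mul_mem_mul hx hy
    rw [tensorPart, tensorPart, Submodule.span_mul_span] at h
    refine Submodule.span_le.2 ?_ h
    rintro _ ⟨_, ⟨j, l, a, ha, b, hb, rfl, rfl⟩, _, ⟨j', l', a', ha', b', hb', rfl, rfl⟩, rfl⟩
    dsimp only
    rw [tmul_mul_tmul a hb ha' b']
    exact intUnits_smul_mem _ _ (tmul_mem_tensorPart (SetLike.GradedMul.mul_mem ha ha')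
      (SetLike.GradedMul.mul_mem hb hb') (by ring))

theorem map_proj_mem_tensorPart (j l : ZMod 2) (x : A ⊗[k] B) :
    GradedTensorProduct.of k 𝒜 ℬ
      (TensorProduct.map (GradedAlgebra.proj 𝒜 j) (GradedAlgebra.proj ℬ l) x) ∈
      tensorPart 𝒜 ℬ (j + l) := by
  induction x using TensorProduct.induction_on with
  | zero => simp
  | tmul a b => exact tmul_mem_tensorPart (SetLike.coe_mem _) (SetLike.coe_mem _) rfl
  | add x y hx hy => rw [map_add, map_add]; exact add_mem hx hy

variable (𝒜 ℬ) in
/-- The decomposition of the tensor product of two superalgebras by total parity. -/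
def tensorDecompose : 𝒜 ᵍ⊗[k] ℬ →ₗ[k] ⨁ i, tensorPart 𝒜 ℬ i :=
  ∑ j, ∑ l, (DirectSum.lof k (ZMod 2) (fun i => tensorPart 𝒜 ℬ i) (j + l)) ∘ₗ
    LinearMap.codRestrict (tensorPart 𝒜 ℬ (j + l))
      ((GradedTensorProduct.of k 𝒜 ℬ).toLinearMap ∘ₗ
        TensorProduct.map (GradedAlgebra.proj 𝒜 j) (GradedAlgebra.proj ℬ l) ∘ₗ
        (GradedTensorProduct.of k 𝒜 ℬ).symm.toLinearMap)
      (fun _ => map_proj_mem_tensorPart j l _)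

theorem tensorDecompose_tmul {j l : ZMod 2} {a : A} {b : B} (ha : a ∈ 𝒜 j) (hb : b ∈ ℬ l) :
    tensorDecompose 𝒜 ℬ (a ᵍ⊗ₜ[k] b) = DirectSum.lof k (ZMod 2) (fun i => tensorPart 𝒜 ℬ i) (j + l)
      ⟨a ᵍ⊗ₜ[k] b, tmul_mem_tensorPart ha hb rfl⟩ := by
  have key (j' l' : ZMod 2) : GradedTensorProduct.of k 𝒜 ℬ (TensorProduct.map
      (GradedAlgebra.proj 𝒜 j') (GradedAlgebra.proj ℬ l') (a ⊗ₜ b)) =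
      if j' = j ∧ l' = l then a ᵍ⊗ₜ[k] b else 0 := by
    rw [TensorProduct.map_tmul, GradedAlgebra.proj_apply, GradedAlgebra.proj_apply]
    by_cases hj : j' = j
    · by_cases hl : l' = l
      · subst hj hl
        rw [DirectSum.decompose_of_mem_same 𝒜 ha, DirectSum.decompose_of_mem_same ℬ hb]
        simp
      · rw [DirectSum.decompose_of_mem_ne ℬ hb (Ne.symm hl)]
        simp [hl]
    · rw [DirectSum.decompose_of_mem_ne 𝒜 ha (Ne.symm hj)]
      simp [hj]
  rw [tensorDecompose, LinearMap.sum_apply, Finset.sum_eq_single j, LinearMap.sum_apply,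
    Finset.sum_eq_single l]
  · rw [LinearMap.comp_apply]
    congr 1
    refine Subtype.ext ((key j l).trans ?_)
    simp
  · intro l' _ hl'
    rw [LinearMap.comp_apply]
    refine (congrArg _ (Subtype.ext ((key j l').trans ?_))).trans (map_zero _)
    simp [hl']
  · simp
  · intro j' _ hj'
    rw [LinearMap.sum_apply]
    refine Finset.sum_eq_zero fun l' _ => ?_
    rw [LinearMap.comp_apply]
    refine (congrArg _ (Subtype.ext ((key j' l').trans ?_))).trans (map_zero _)
    simp [hj']
  · simp

/-- A property of elements of a tensor product of superalgebras holds if it is additive and holds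
for the tensors of homogeneous elements. -/
theorem gradedTensor_induction {P : 𝒜 ᵍ⊗[k] ℬ → Prop} (zero : P 0)
    (tmul : ∀ j l, ∀ a ∈ 𝒜 j, ∀ b ∈ ℬ l, P (a ᵍ⊗ₜ[k] b)) (add : ∀ x y, P x → P y → P (x + y))
    (x : 𝒜 ᵍ⊗[k] ℬ) : P x := by
  obtain ⟨x, rfl⟩ := (GradedTensorProduct.of k 𝒜 ℬ).surjective x
  induction x using TensorProduct.induction_on with
  | zero => simpa using zero
  | tmul a b =>
    induction a using DirectSum.Decomposition.inductionOn 𝒜 with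
    | zero => simpa using zero
    | add a a' ha ha' => rw [TensorProduct.add_tmul, map_add]; exact add _ _ ha ha'
    | homogeneous a =>
      induction b using DirectSum.Decomposition.inductionOn ℬ with
      | zero => simpa using zero
      | add b b' hb hb' => rw [TensorProduct.tmul_add, map_add]; exact add _ _ hb hb'
      | homogeneous b => exact tmul _ _ a a.2 b b.2
  | add x y hx hy => rw [map_add]; exact add _ _ hx hy

/-- The tensor product of two superalgebras is a superalgebra. -/
instance tensorPart.gradedAlgebra : GradedAlgebra (tensorPart 𝒜 ℬ) where
  decompose' := tensorDecompose 𝒜 ℬ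
  left_inv x := by
    induction x using gradedTensor_induction with
    | zero => simp
    | tmul j l a ha b hb =>
      rw [tensorDecompose_tmul ha hb]
      exact DirectSum.coeAddMonoidHom_of _ _ _
    | add x y hx hy => rw [map_add, map_add, hx, hy]
  right_inv x := by
    induction x using DirectSum.induction_on with
    | zero => simp
    | of i x =>
      rw [DirectSum.coeAddMonoidHom_of]
      obtain ⟨x, hx⟩ := x
      dsimp only
      induction hx using Submodule.span_induction with
      | mem x h =>
        obtain ⟨j, l, a, ha, b, hb, rfl, rfl⟩ := h
        exact tensorDecompose_tmul ha hb
      | zero => rw [map_zero]; exact (map_zero _).symm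
      | add x y hx hy ihx ihy => rw [map_add, ihx, ihy, ← map_add]; rfl
      | smul c x hx ih =>
        rw [map_smul, ih]
        exact (map_smul (DirectSum.lof k (ZMod 2) (fun i => tensorPart 𝒜 ℬ i) i) c ⟨x, hx⟩).symm
    | add x y hx hy => rw [map_add, map_add, hx, hy]

theorem of_symm_mem_of_mem_tensorPart (i : ZMod 2) {x : 𝒜 ᵍ⊗[k] ℬ} (hx : x ∈ tensorPart 𝒜 ℬ i) :
    (GradedTensorProduct.of k 𝒜 ℬ).symm x ∈
      ⨆ j : ZMod 2, LinearMap.range (TensorProduct.map (𝒜 j).subtype (ℬ (i - j)).subtype) := by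
  have : tensorPart 𝒜 ℬ i ≤ (⨆ j : ZMod 2, LinearMap.range
      (TensorProduct.map (𝒜 j).subtype (ℬ (i - j)).subtype)).comap
      (GradedTensorProduct.of k 𝒜 ℬ).symm.toLinearMap := by
    refine Submodule.span_le.2 ?_
    rintro _ ⟨j, l, a, ha, b, hb, rfl, rfl⟩
    refine Submodule.mem_iSup_of_mem j ?_
    rw [add_sub_cancel_left]
    exact ⟨⟨a, ha⟩ ⊗ₜ ⟨b, hb⟩, rfl⟩
  exact this hx

theorem isSupercommutative_tensorPart (h𝒜 : IsSupercommutative 𝒜) (hℬ : IsSupercommutative ℬ) :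
    IsSupercommutative (tensorPart 𝒜 ℬ) := by
  intro i i' x hx y hy
  induction hx, hy using Submodule.span_induction₂ with
  | mem_mem x y hx hy =>
    obtain ⟨j, l, a, ha, b, hb, rfl, rfl⟩ := hx
    obtain ⟨j', l', a', ha', b', hb', rfl, rfl⟩ := hy
    have hsmul : ∀ (u v : ℤˣ) (a : A) (b : B),
        ((u • a) ᵍ⊗ₜ[k] (v • b) : 𝒜 ᵍ⊗[k] ℬ) = (u * v) • (a ᵍ⊗ₜ[k] b) := by
      intro u v a b
      rcases Int.units_eq_one_or u with rfl | rfl <;>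
        rcases Int.units_eq_one_or v with rfl | rfl <;>
        simp [GradedTensorProduct.tmul, TensorProduct.neg_tmul, TensorProduct.tmul_neg]
    rw [tmul_mul_tmul a hb ha' b', tmul_mul_tmul a' hb' ha b, h𝒜 j j' a ha a' ha',
      hℬ l l' b hb b' hb', hsmul, smul_smul, smul_smul]
    congr 1
    rw [add_mul, mul_add, mul_add, uzpow_add, uzpow_add, uzpow_add, mul_comm l' j]
    generalize (-1 : ℤˣ) ^ (j * l') = u
    rcases Int.units_eq_one_or u with rfl | rfl <;> simp [mul_comm, mul_left_comm]
  | zero_left y hy => simp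
  | zero_right x hx => simp
  | add_left x y z hx hy hz h₁ h₂ => rw [add_mul, mul_add, h₁, h₂, smul_add]
  | add_right x y z hx hy hz h₁ h₂ => rw [add_mul, mul_add, h₁, h₂, smul_add]
  | smul_left r x y hx hy h => rw [smul_mul_assoc, mul_smul_comm, h, smul_comm]
  | smul_right r x y hx hy h => rw [smul_mul_assoc, mul_smul_comm, h, smul_comm]

instance strictlySupercommutative_tensorPart [StrictlySupercommutative 𝒜]
    [StrictlySupercommutative ℬ] : StrictlySupercommutative (tensorPart 𝒜 ℬ) where
  comm := isSupercommutative_tensorPart StrictlySupercommutative.comm StrictlySupercommutative.comm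
  sq x hx := by
    have hanti := (isSupercommutative_iff.1 (isSupercommutative_tensorPart (𝒜 := 𝒜) (ℬ := ℬ)
      StrictlySupercommutative.comm StrictlySupercommutative.comm)).2
    induction hx using Submodule.span_induction with
    | mem x h =>
      obtain ⟨j, l, a, ha, b, hb, hjl, rfl⟩ := h
      rw [tmul_mul_tmul a hb ha b]
      rcases parity_eq_zero_or_one j with rfl | rfl
      · obtain rfl : l = 1 := by simpa using hjl
        simp [odd_sq hb]
      · simp [odd_sq ha, GradedTensorProduct.tmul]
    | zero => simp
    | add x y hx hy ihx ihy =>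
      rw [add_mul, mul_add, mul_add, ihx, ihy, hanti x hx y hy]
      simp
    | smul c x hx ih => rw [smul_mul_smul_comm, ih, smul_zero]

variable {C : Type*} [Ring C] [Algebra k C] {𝒞 : ZMod 2 → Submodule k C}

variable (𝒜 ℬ) in
/-- The morphism from a tensor product induced by two morphisms to a supercommutative
superalgebra. -/
def superLift [StrictlySupercommutative 𝒞] (f : A →ₐ[k] C) (g : B →ₐ[k] C)
    (hf : ∀ i, ∀ a ∈ 𝒜 i, f a ∈ 𝒞 i) (hg : ∀ i, ∀ b ∈ ℬ i, g b ∈ 𝒞 i) : 𝒜 ᵍ⊗[k] ℬ →ₐ[k] C :=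
  GradedTensorProduct.lift 𝒜 ℬ f g fun i j a b => by
    rw [mul_comm j i]
    exact StrictlySupercommutative.comm i j _ (hf i a a.2) _ (hg j b b.2)

variable {f : A →ₐ[k] C} {g : B →ₐ[k] C} {hf : ∀ i, ∀ a ∈ 𝒜 i, f a ∈ 𝒞 i}
  {hg : ∀ i, ∀ b ∈ ℬ i, g b ∈ 𝒞 i}

@[simp]
theorem superLift_tmul [StrictlySupercommutative 𝒞] (a : A) (b : B) :
    superLift 𝒜 ℬ f g hf hg (a ᵍ⊗ₜ[k] b) = f a * g b :=
  GradedTensorProduct.lift_tmul 𝒜 ℬ f g _ a b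

theorem superLift_mem [StrictlySupercommutative 𝒞] [SetLike.GradedMonoid 𝒞] (i : ZMod 2)
    (x : 𝒜 ᵍ⊗[k] ℬ) (hx : x ∈ tensorPart 𝒜 ℬ i) : superLift 𝒜 ℬ f g hf hg x ∈ 𝒞 i := by
  have : tensorPart 𝒜 ℬ i ≤ (𝒞 i).comap (superLift 𝒜 ℬ f g hf hg).toLinearMap := by
    refine Submodule.span_le.2 ?_
    rintro _ ⟨j, l, a, ha, b, hb, rfl, rfl⟩
    change superLift 𝒜 ℬ f g hf hg (a ᵍ⊗ₜ[k] b) ∈ 𝒞 (j + l)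
    rw [superLift_tmul]
    exact SetLike.GradedMul.mul_mem (hf j a ha) (hg l b hb)
  exact this hx

theorem includeLeft_mem (i : ZMod 2) (a : A) (ha : a ∈ 𝒜 i) :
    GradedTensorProduct.includeLeft 𝒜 ℬ a ∈ tensorPart 𝒜 ℬ i :=
  tmul_mem_tensorPart ha (SetLike.GradedOne.one_mem (A := ℬ)) (add_zero i)

theorem includeRight_mem (i : ZMod 2) (b : B) (hb : b ∈ ℬ i) :
    GradedTensorProduct.includeRight 𝒜 ℬ b ∈ tensorPart 𝒜 ℬ i :=
  tmul_mem_tensorPart (SetLike.GradedOne.one_mem (A := 𝒜)) hb (zero_add i)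

theorem includeLeft_mul_includeRight (a : A) (b : B) :
    GradedTensorProduct.includeLeft 𝒜 ℬ a * GradedTensorProduct.includeRight 𝒜 ℬ b =
      a ᵍ⊗ₜ[k] b :=
  GradedTensorProduct.tmul_one_mul_one_tmul 𝒜 ℬ a b

end Tensor

/-! ### Super bialgebras from morphisms of superalgebras -/

section Bialgebra

open GradedTensorProduct

variable {k A : Type*} [CommRing k] [Ring A] [Algebra k A]
variable {𝒜 : ZMod 2 → Submodule k A} [GradedAlgebra 𝒜]

theorem includeRight_comp_mem {B : Type*} [Ring B] [Algebra k B] {ℬ : ZMod 2 → Submodule k B}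
    [GradedAlgebra ℬ] {f : A →ₐ[k] B} (hf : ∀ i, ∀ a ∈ 𝒜 i, f a ∈ ℬ i) (i : ZMod 2) (a : A)
    (ha : a ∈ 𝒜 i) : (includeRight 𝒜 ℬ).comp f a ∈ tensorPart 𝒜 ℬ i :=
  includeRight_mem i _ (hf i a ha)

theorem ofId_comp_mem {ε : A →ₐ[k] k} (hε : ∀ a ∈ 𝒜 1, ε a = 0) (i : ZMod 2) (a : A)
    (ha : a ∈ 𝒜 i) : (Algebra.ofId k A).comp ε a ∈ 𝒜 i := by
  rcases parity_eq_zero_or_one i with rfl | rfl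
  · exact SetLike.algebraMap_mem_graded 𝒜 _
  · simp [hε a ha]

variable [StrictlySupercommutative 𝒜]

variable (𝒜) in
/-- The morphism `a ⊗ b ↦ a ⊗ (b ⊗ 1)`. -/
def tensorIncl : 𝒜 ᵍ⊗[k] 𝒜 →ₐ[k] 𝒜 ᵍ⊗[k] tensorPart 𝒜 𝒜 :=
  superLift 𝒜 𝒜 (𝒞 := tensorPart 𝒜 (tensorPart 𝒜 𝒜)) (includeLeft 𝒜 (tensorPart 𝒜 𝒜))
    ((includeRight 𝒜 (tensorPart 𝒜 𝒜)).comp (includeLeft 𝒜 𝒜)) includeLeft_mem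
    (includeRight_comp_mem includeLeft_mem)

theorem tensorIncl_mem (i : ZMod 2) (x : 𝒜 ᵍ⊗[k] 𝒜) (hx : x ∈ tensorPart 𝒜 𝒜 i) :
    tensorIncl 𝒜 x ∈ tensorPart 𝒜 (tensorPart 𝒜 𝒜) i :=
  superLift_mem (hf := includeLeft_mem) (hg := includeRight_comp_mem includeLeft_mem) i x hx

/-- `tensorIncl (a ⊗ b)` times `1 ⊗ (1 ⊗ c)` is the associator applied to `(a ⊗ b) ⊗ c`. -/
theorem tensorIncl_tmul_mul (a b c : A) :
    tensorIncl 𝒜 (a ᵍ⊗ₜ[k] b) * includeRight 𝒜 (tensorPart 𝒜 𝒜) (includeRight 𝒜 𝒜 c) =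
      a ᵍ⊗ₜ[k] (b ᵍ⊗ₜ[k] c) := by
  have h : tensorIncl 𝒜 (a ᵍ⊗ₜ[k] b) = includeLeft 𝒜 (tensorPart 𝒜 𝒜) a *
      includeRight 𝒜 (tensorPart 𝒜 𝒜) (includeLeft 𝒜 𝒜 b) :=
    superLift_tmul (hf := includeLeft_mem) (hg := includeRight_comp_mem includeLeft_mem) a b
  rw [h, mul_assoc, ← map_mul, includeLeft_mul_includeRight, includeLeft_mul_includeRight]

variable (Δ : A →ₐ[k] 𝒜 ᵍ⊗[k] 𝒜) (ε : A →ₐ[k] k)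
  (hΔ : ∀ i, ∀ a ∈ 𝒜 i, Δ a ∈ tensorPart 𝒜 𝒜 i) (hε : ∀ a ∈ 𝒜 1, ε a = 0)

/-- The morphism `Δ ⊗ id` followed by `(A ⊗ A) ⊗ A ≃ A ⊗ (A ⊗ A)`. -/
def comulLeft : 𝒜 ᵍ⊗[k] 𝒜 →ₐ[k] 𝒜 ᵍ⊗[k] tensorPart 𝒜 𝒜 :=
  superLift 𝒜 𝒜 (𝒞 := tensorPart 𝒜 (tensorPart 𝒜 𝒜)) ((tensorIncl 𝒜).comp Δ)
    ((includeRight 𝒜 (tensorPart 𝒜 𝒜)).comp (includeRight 𝒜 𝒜))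
    (fun i a ha => tensorIncl_mem i _ (hΔ i a ha)) (includeRight_comp_mem includeRight_mem)

theorem comulLeft_tmul (a b : A) : comulLeft Δ hΔ (a ᵍ⊗ₜ[k] b) =
    tensorIncl 𝒜 (Δ a) * includeRight 𝒜 (tensorPart 𝒜 𝒜) (includeRight 𝒜 𝒜 b) :=
  superLift_tmul (hf := fun i a ha => tensorIncl_mem i _ (hΔ i a ha))
    (hg := includeRight_comp_mem includeRight_mem) a b

/-- The morphism `id ⊗ Δ`. -/
def comulRight : 𝒜 ᵍ⊗[k] 𝒜 →ₐ[k] 𝒜 ᵍ⊗[k] tensorPart 𝒜 𝒜 :=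
  superLift 𝒜 𝒜 (𝒞 := tensorPart 𝒜 (tensorPart 𝒜 𝒜)) (includeLeft 𝒜 (tensorPart 𝒜 𝒜))
    ((includeRight 𝒜 (tensorPart 𝒜 𝒜)).comp Δ) includeLeft_mem (includeRight_comp_mem hΔ)

theorem comulRight_tmul (a b : A) : comulRight Δ hΔ (a ᵍ⊗ₜ[k] b) = a ᵍ⊗ₜ[k] Δ b :=
  (superLift_tmul (hf := includeLeft_mem) (hg := includeRight_comp_mem hΔ) a b).trans
    (includeLeft_mul_includeRight a (Δ b))

/-- The morphism `ε ⊗ id` with values in `k ⊗ A = A`. -/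
def counitLeft : 𝒜 ᵍ⊗[k] 𝒜 →ₐ[k] A :=
  superLift 𝒜 𝒜 (𝒞 := 𝒜) ((Algebra.ofId k A).comp ε) (AlgHom.id k A)
    (ofId_comp_mem hε) fun _ _ h => h

theorem counitLeft_tmul (a b : A) : counitLeft ε hε (a ᵍ⊗ₜ[k] b) = ε a • b :=
  (superLift_tmul (hf := ofId_comp_mem hε) (hg := fun _ _ h => h) a b).trans
    (Algebra.smul_def _ _).symm

/-- The morphism `id ⊗ ε` with values in `A ⊗ k = A`. -/
def counitRight : 𝒜 ᵍ⊗[k] 𝒜 →ₐ[k] A :=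
  superLift 𝒜 𝒜 (𝒞 := 𝒜) (AlgHom.id k A) ((Algebra.ofId k A).comp ε)
    (fun _ _ h => h) (ofId_comp_mem hε)

theorem counitRight_tmul (a b : A) : counitRight ε hε (a ᵍ⊗ₜ[k] b) = ε b • a :=
  (superLift_tmul (hf := fun _ _ h => h) (hg := ofId_comp_mem hε) a b).trans
    ((Algebra.commutes _ _).symm.trans (Algebra.smul_def _ _).symm)

/-- A superalgebra with morphisms `Δ`, `ε` that satisfy the laws of a coalgebra, stated as
equalities of morphisms of superalgebras, is a super bialgebra. -/
def superBialgebraOfAlgHom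
    (hassoc : (comulLeft Δ hΔ).comp Δ = (comulRight Δ hΔ).comp Δ)
    (hleft : (counitLeft ε hε).comp Δ = AlgHom.id k A)
    (hright : (counitRight ε hε).comp Δ = AlgHom.id k A) : SuperBialgebra 𝒜 where
  comul := (of k 𝒜 𝒜).symm.toLinearMap ∘ₗ Δ.toLinearMap
  counit := ε.toLinearMap
  coassoc := by
    -- the identification of the target of `comulLeft` and `comulRight` with `A ⊗ (A ⊗ A)`
    let E : 𝒜 ᵍ⊗[k] tensorPart 𝒜 𝒜 →ₗ[k] A ⊗[k] (A ⊗[k] A) :=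
      (of k 𝒜 𝒜).symm.toLinearMap.lTensor A ∘ₗ (of k 𝒜 (tensorPart 𝒜 𝒜)).symm.toLinearMap
    have hE (z : A ⊗[k] A) (c : A) : E (tensorIncl 𝒜 (of k 𝒜 𝒜 z) *
        includeRight 𝒜 (tensorPart 𝒜 𝒜) (includeRight 𝒜 𝒜 c)) =
        TensorProduct.assoc k A A A (z ⊗ₜ c) := by
      induction z using TensorProduct.induction_on with
      | zero => simp
      | tmul a b => rw [tensorIncl_tmul_mul]; rfl
      | add x y hx hy =>
        rw [map_add, map_add, add_mul, map_add, hx, hy, TensorProduct.add_tmul, map_add]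
    have hL (z : A ⊗[k] A) : E (comulLeft Δ hΔ (of k 𝒜 𝒜 z)) = TensorProduct.assoc k A A A
        (((of k 𝒜 𝒜).symm.toLinearMap ∘ₗ Δ.toLinearMap).rTensor A z) := by
      induction z using TensorProduct.induction_on with
      | zero => simp
      | tmul a b => exact (congrArg E (comulLeft_tmul Δ hΔ a b)).trans (hE _ b)
      | add x y hx hy => simp only [map_add, hx, hy]
    have hR (z : A ⊗[k] A) : E (comulRight Δ hΔ (of k 𝒜 𝒜 z)) =
        ((of k 𝒜 𝒜).symm.toLinearMap ∘ₗ Δ.toLinearMap).lTensor A z := by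
      induction z using TensorProduct.induction_on with
      | zero => simp
      | tmul a b => exact congrArg E (comulRight_tmul Δ hΔ a b)
      | add x y hx hy => simp only [map_add, hx, hy]
    refine LinearMap.ext fun a => ?_
    exact (hL _).symm.trans ((congrArg E (AlgHom.congr_fun hassoc a)).trans (hR _))
  rTensor_counit_comp_comul := by
    have h (z : A ⊗[k] A) : TensorProduct.lid k A (ε.toLinearMap.rTensor A z) =
        counitLeft ε hε (of k 𝒜 𝒜 z) := by
      induction z using TensorProduct.induction_on with
      | zero => simp
      | tmul a b => exact (counitLeft_tmul ε hε a b).symm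
      | add x y hx hy => simp only [map_add, hx, hy]
    refine LinearMap.ext fun a => (TensorProduct.lid k A).injective ?_
    exact (h _).trans ((AlgHom.congr_fun hleft a).trans (one_smul k a).symm)
  lTensor_counit_comp_comul := by
    have h (z : A ⊗[k] A) : TensorProduct.rid k A (ε.toLinearMap.lTensor A z) =
        counitRight ε hε (of k 𝒜 𝒜 z) := by
      induction z using TensorProduct.induction_on with
      | zero => simp
      | tmul a b => exact (counitRight_tmul ε hε a b).symm
      | add x y hx hy => simp only [map_add, hx, hy]
    refine LinearMap.ext fun a => (TensorProduct.rid k A).injective ?_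
    exact (h _).trans ((AlgHom.congr_fun hright a).trans (one_smul k a).symm)
  comul_one := map_one Δ
  comul_mul := map_mul Δ
  comul_mem i a ha := of_symm_mem_of_mem_tensorPart i (hΔ i a ha)
  counit_one := map_one ε
  counit_mul := map_mul ε
  counit_odd := hε

end Bialgebra

/-! ### Superalgebras generated by the entries of a supermatrix -/

section Standard

variable {m n : ℕ}

theorem map_det_inv₁ {A C : Type*} [Ring A] [Ring C] (f : A →+* C) {g : Gen m n → A}
    (h : f (g .dinv₁ * det (X₁₁ g)) = 1) : (f ∘ g) .dinv₁ * det (X₁₁ (f ∘ g)) = 1 := by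
  rwa [map_mul, map_det] at h

theorem map_det_inv₂ {A C : Type*} [Ring A] [Ring C] (f : A →+* C) {g : Gen m n → A}
    (h : f (g .dinv₂ * det (X₂₂ g)) = 1) : (f ∘ g) .dinv₂ * det (X₂₂ (f ∘ g)) = 1 := by
  rwa [map_mul, map_det] at h

variable {k A : Type*} [CommRing k] [Ring A] [Algebra k A]

/-- The superalgebra `A` is generated by the family `g` of elements of the prescribed parities, in
the sense that the part of parity `i` is spanned by the words of parity `i`; and `g dinv₁`,
`g dinv₂` are inverse to the determinants of the diagonal blocks. -/
structure IsStandard (𝒜 : ZMod 2 → Submodule k A) (g : Gen m n → A) : Prop where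
  span : ∀ i, 𝒜 i =
    Submodule.span k {w | ∃ l : List (Gen m n), (l.map Gen.parity).sum = i ∧ w = (l.map g).prod}
  inv₁ : g .dinv₁ * det (X₁₁ g) = 1
  inv₂ : g .dinv₂ * det (X₂₂ g) = 1

variable {𝒜 : ZMod 2 → Submodule k A} {g : Gen m n → A}

theorem prod_map_mul_gen {g : Gen m n → A}
    (hcomm : ∀ x y, g x * g y = (-1 : ℤˣ) ^ (x.parity * y.parity) • (g y * g x))
    (l : List (Gen m n)) (y : Gen m n) : (l.map g).prod * g y =
      (-1 : ℤˣ) ^ ((l.map Gen.parity).sum * y.parity) • (g y * (l.map g).prod) := by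
  induction l with
  | nil => simp
  | cons x l ih =>
    simp only [List.map_cons, List.prod_cons, List.sum_cons]
    rw [mul_assoc, ih, mul_smul_comm, ← mul_assoc, hcomm, smul_mul_assoc, smul_smul, mul_assoc,
      add_mul, uzpow_add, mul_comm]

theorem prod_map_mul_prod_map {g : Gen m n → A}
    (hcomm : ∀ x y, g x * g y = (-1 : ℤˣ) ^ (x.parity * y.parity) • (g y * g x))
    (l l' : List (Gen m n)) : (l.map g).prod * (l'.map g).prod =
      (-1 : ℤˣ) ^ ((l.map Gen.parity).sum * (l'.map Gen.parity).sum) •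
        ((l'.map g).prod * (l.map g).prod) := by
  induction l' with
  | nil => simp
  | cons x l' ih =>
    simp only [List.map_cons, List.prod_cons, List.sum_cons]
    rw [← mul_assoc, prod_map_mul_gen hcomm, smul_mul_assoc, mul_assoc, ih, mul_smul_comm,
      smul_smul, ← mul_assoc, mul_add, uzpow_add]

theorem prod_map_mul_self_of_odd {g : Gen m n → A}
    (hcomm : ∀ x y, g x * g y = (-1 : ℤˣ) ^ (x.parity * y.parity) • (g y * g x))
    (hsq : ∀ x : Gen m n, x.parity = 1 → g x * g x = 0)
    (l : List (Gen m n)) (hl : (l.map Gen.parity).sum = 1) :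
    (l.map g).prod * (l.map g).prod = 0 := by
  induction l with
  | nil => simp at hl
  | cons x l ih =>
    simp only [List.map_cons, List.prod_cons, List.sum_cons] at hl ⊢
    rw [mul_assoc, ← mul_assoc (l.map g).prod, prod_map_mul_gen hcomm, smul_mul_assoc,
      mul_smul_comm, mul_assoc, ← mul_assoc (g x)]
    rcases parity_eq_zero_or_one x.parity with hx | hx
    · rw [hx, zero_add] at hl
      rw [ih hl, mul_zero, smul_zero]
    · rw [hsq x hx, zero_mul, smul_zero]

/-- It suffices to check strict supercommutativity on generators. -/
theorem StrictlySupercommutative.of_gen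
    (hspan : ∀ i, 𝒜 i = Submodule.span k
      {w | ∃ l : List (Gen m n), (l.map Gen.parity).sum = i ∧ w = (l.map g).prod})
    (hcomm : ∀ x y, g x * g y = (-1 : ℤˣ) ^ (x.parity * y.parity) • (g y * g x))
    (hsq : ∀ x : Gen m n, x.parity = 1 → g x * g x = 0) : StrictlySupercommutative 𝒜 := by
  have hcomm' : IsSupercommutative 𝒜 := by
    intro i j x hx y hy
    rw [hspan] at hx hy
    induction hx, hy using Submodule.span_induction₂ with
    | mem_mem x y hx hy =>
      obtain ⟨l, rfl, rfl⟩ := hx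
      obtain ⟨l', rfl, rfl⟩ := hy
      exact prod_map_mul_prod_map hcomm l l'
    | zero_left y hy => simp
    | zero_right x hx => simp
    | add_left x y z hx hy hz h₁ h₂ => rw [add_mul, mul_add, h₁, h₂, smul_add]
    | add_right x y z hx hy hz h₁ h₂ => rw [add_mul, mul_add, h₁, h₂, smul_add]
    | smul_left r x y hx hy h => rw [smul_mul_assoc, mul_smul_comm, h, smul_comm]
    | smul_right r x y hx hy h => rw [smul_mul_assoc, mul_smul_comm, h, smul_comm]
  refine ⟨hcomm', fun x hx => ?_⟩
  have hanti := (isSupercommutative_iff.1 hcomm').2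
  rw [hspan] at hx hanti
  induction hx using Submodule.span_induction with
  | mem x h =>
    obtain ⟨l, hl, rfl⟩ := h
    exact prod_map_mul_self_of_odd hcomm hsq l hl
  | zero => simp
  | add x y hx hy ihx ihy =>
    rw [add_mul, mul_add, mul_add, ihx, ihy, hanti x hx y hy]
    simp
  | smul c x hx ih => rw [smul_mul_smul_comm, ih, smul_zero]

namespace IsStandard

theorem gen_mem (hg : IsStandard 𝒜 g) (x : Gen m n) : g x ∈ 𝒜 x.parity := by
  rw [hg.span]
  exact Submodule.subset_span ⟨[x], by simp, by simp⟩

theorem map_mem {C : Type*} [Ring C] [Algebra k C] {𝒞 : ZMod 2 → Submodule k C}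
    [SetLike.GradedMonoid 𝒞] (hg : IsStandard 𝒜 g) {f : A →ₐ[k] C}
    (hf : ∀ x, f (g x) ∈ 𝒞 x.parity) (i : ZMod 2) (a : A) (ha : a ∈ 𝒜 i) : f a ∈ 𝒞 i := by
  rw [hg.span] at ha
  have : Submodule.span k
      {w | ∃ l : List (Gen m n), (l.map Gen.parity).sum = i ∧ w = (l.map g).prod} ≤
      (𝒞 i).comap f.toLinearMap := by
    refine Submodule.span_le.2 ?_
    rintro _ ⟨l, rfl, rfl⟩
    change f (l.map g).prod ∈ 𝒞 (l.map Gen.parity).sum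
    rw [map_list_prod, List.map_map]
    exact SetLike.list_prod_map_mem_graded l _ _ fun x _ => hf x
  exact this ha

variable [GradedAlgebra 𝒜] [StrictlySupercommutative 𝒜]

theorem det_mul_inv₁ (hg : IsStandard 𝒜 g) : det (X₁₁ g) * g .dinv₁ = 1 := by
  rw [← hg.inv₁]
  exact even_comm (ℬ := 𝒜) (det_mem (X₁₁_mem hg.gen_mem)) (hg.gen_mem .dinv₁)

theorem det_mul_inv₂ (hg : IsStandard 𝒜 g) : det (X₂₂ g) * g .dinv₂ = 1 := by
  rw [← hg.inv₂]
  exact even_comm (ℬ := 𝒜) (det_mem (X₂₂_mem hg.gen_mem)) (hg.gen_mem .dinv₂)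

/-- A morphism is determined by the images of the entries of the supermatrix: these determine the
images of the two determinants, hence those of their inverses. -/
theorem algHom_ext (hg : IsStandard 𝒜 g) {C : Type*} [Ring C] [Algebra k C] {f f' : A →ₐ[k] C}
    (h : ∀ i j, f (g (.a i j)) = f' (g (.a i j))) : f = f' := by
  have hinv {d e : A} (hed : e * d = 1) (hde : d * e = 1) (hd : f d = f' d) : f e = f' e := by
    refine left_inv_eq_right_inv (a := f d) ?_ ?_
    · rw [← map_mul, hed, map_one]
    · rw [hd, ← map_mul, hde, map_one]
  have hgen : ∀ x, f (g x) = f' (g x) := by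
    rintro (⟨i, j⟩ | _ | _)
    · exact h i j
    · refine hinv hg.inv₁ hg.det_mul_inv₁ ?_
      refine (map_det f.toRingHom _).trans (Eq.trans ?_ (map_det f'.toRingHom _).symm)
      congr 1
      ext i j
      exact h _ _
    · refine hinv hg.inv₂ hg.det_mul_inv₂ ?_
      refine (map_det f.toRingHom _).trans (Eq.trans ?_ (map_det f'.toRingHom _).symm)
      congr 1
      ext i j
      exact h _ _
  have hpart (i : ZMod 2) : 𝒜 i ≤ LinearMap.eqLocus f.toLinearMap f'.toLinearMap := by
    rw [hg.span, Submodule.span_le]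
    rintro _ ⟨l, -, rfl⟩
    change f (l.map g).prod = f' (l.map g).prod
    rw [map_list_prod, map_list_prod, List.map_map, List.map_map]
    congr 2
    exact funext hgen
  refine AlgHom.ext fun a => ?_
  induction a using DirectSum.Decomposition.inductionOn 𝒜 with
  | zero => rw [map_zero, map_zero]
  | homogeneous a => exact hpart _ a.2
  | add a b ha hb => rw [map_add, map_add, ha, hb]

end IsStandard

end Standard

/-! ### The comultiplication and the counit on generators -/

section Comul

open GradedTensorProduct

/-- The values of the counit on generators. -/
def counitGen (k : Type*) [CommRing k] {m n : ℕ} : Gen m n → k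
  | .a i j => if i = j then 1 else 0
  | .dinv₁ => 1
  | .dinv₂ => 1

theorem counitGen_eq_zero_of_odd {k : Type*} [CommRing k] {m n : ℕ} (x : Gen m n)
    (hx : x.parity = 1) : counitGen k x = 0 := by
  rcases x with ⟨i, j⟩ | _ | _
  · rw [counitGen, if_neg]
    rintro rfl
    exact zero_ne_one ((CharTwo.add_self_eq_zero (indexParity i)).symm.trans hx)
  · exact absurd hx zero_ne_one
  · exact absurd hx zero_ne_one

/-- The partial sums of the geometric series for `(d + N)⁻¹`. -/
theorem sum_Icc_inv_mul_add {C : Type*} [CommRing C] {e d N : C} (hed : e * d = 1) (K : ℕ) :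
    (∑ i ∈ Finset.Icc 1 K, (-1) ^ (i - 1) * e ^ i * N ^ (i - 1)) * (d + N) =
      1 - (-1) ^ K * e ^ K * N ^ K := by
  induction K with
  | zero => simp
  | succ K ih =>
    rw [Finset.sum_Icc_succ_top (by omega), add_mul, ih, Nat.add_sub_cancel]
    linear_combination ((-1) ^ K * e ^ K * N ^ K) * hed

/-- If the even elements `D` and `d` differ by a nilpotent and `d` has the inverse `e`, then the
geometric series is an inverse of `D`. -/
theorem even_sum_Icc_inv_mul {k B : Type*} [CommRing k] [Ring B] [Algebra k B]
    {ℬ : ZMod 2 → Submodule k B} [SetLike.GradedMonoid ℬ] [StrictlySupercommutative ℬ] {e d D : B}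
    (he : e ∈ ℬ 0) (hd : d ∈ ℬ 0) (hD : D ∈ ℬ 0) (hed : e * d = 1) {K : ℕ}
    (hK : (D - d) ^ K = 0) :
    (∑ i ∈ Finset.Icc 1 K, (-1) ^ (i - 1) * e ^ i * (D - d) ^ (i - 1)) * D = 1 := by
  have h := congrArg (evenVal ℬ) (sum_Icc_inv_mul_add (C := ℬ 0) (e := ⟨e, he⟩) (d := ⟨d, hd⟩)
    (N := ⟨D, hD⟩ - ⟨d, hd⟩) (Subtype.ext hed) K)
  simp only [map_sub, map_mul, map_add, map_sum, map_pow, map_neg, map_one, evenVal_apply] at h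
  rwa [hK, mul_zero, sub_zero, add_sub_cancel] at h

variable {k A : Type*} [CommRing k] [Ring A] [Algebra k A] {m n : ℕ}
variable {𝒜 : ZMod 2 → Submodule k A} [GradedAlgebra 𝒜]

theorem tmul_self_pow {e : A} (he : e ∈ 𝒜 0) (i : ℕ) :
    (e ᵍ⊗ₜ[k] e : 𝒜 ᵍ⊗[k] 𝒜) ^ i = (e ^ i) ᵍ⊗ₜ[k] (e ^ i) := by
  induction i with
  | zero => simp only [pow_zero]; rfl
  | succ i ih =>
    have hi : e ^ i ∈ 𝒜 0 := by simpa using SetLike.pow_mem_graded i he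
    rw [pow_succ, ih, tmul_mul_tmul _ hi he, pow_succ]
    simp

variable (𝒜) in
/-- The supermatrix `∑_l a i l ⊗ a l j`. -/
def comulMatrix (g : Gen m n → A) : Matrix (Fin m ⊕ Fin n) (Fin m ⊕ Fin n) (𝒜 ᵍ⊗[k] 𝒜) :=
  Matrix.of fun i j => ∑ l, g (.a i l) ᵍ⊗ₜ[k] g (.a l j)

variable (𝒜) in
/-- The alternating sum for the comultiplication of an inverse `e` of `d`, where `D` is the
comultiplication of `d`. -/
def invSeries (m n : ℕ) (e d : A) (D : 𝒜 ᵍ⊗[k] 𝒜) : 𝒜 ᵍ⊗[k] 𝒜 :=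
  ∑ i ∈ Finset.Icc 1 (2 * m * n + 2),
    (-1) ^ (i - 1) * ((e ^ i) ᵍ⊗ₜ[k] (e ^ i)) * (D - (d ᵍ⊗ₜ[k] d)) ^ (i - 1)

variable (𝒜) in
/-- The comultiplication on generators. -/
def comulGen (g : Gen m n → A) : Gen m n → 𝒜 ᵍ⊗[k] 𝒜
  | .a i j => comulMatrix 𝒜 g i j
  | .dinv₁ => invSeries 𝒜 m n (g .dinv₁) (det (X₁₁ g)) (det (comulMatrix 𝒜 g).toBlocks₁₁)
  | .dinv₂ => invSeries 𝒜 m n (g .dinv₂) (det (X₂₂ g)) (det (comulMatrix 𝒜 g).toBlocks₂₂)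

theorem superMatrix_comulGen (g : Gen m n → A) : superMatrix (comulGen 𝒜 g) =
    superMatrix (includeLeft 𝒜 𝒜 ∘ g) * superMatrix (includeRight 𝒜 𝒜 ∘ g) := by
  ext i j
  rw [Matrix.mul_apply]
  change ∑ l, g (.a i l) ᵍ⊗ₜ[k] g (.a l j) =
    ∑ l, includeLeft 𝒜 𝒜 (g (.a i l)) * includeRight 𝒜 𝒜 (g (.a l j))
  simp only [includeLeft_mul_includeRight]

theorem invSeries_mem {e d : A} (he : e ∈ 𝒜 0) (hd : d ∈ 𝒜 0)
    {D : 𝒜 ᵍ⊗[k] 𝒜} (hD : D ∈ tensorPart 𝒜 𝒜 0) : invSeries 𝒜 m n e d D ∈ tensorPart 𝒜 𝒜 0 := by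
  have hpow {x : 𝒜 ᵍ⊗[k] 𝒜} (hx : x ∈ tensorPart 𝒜 𝒜 0) (i : ℕ) : x ^ i ∈ tensorPart 𝒜 𝒜 0 := by
    simpa using SetLike.pow_mem_graded i hx
  simp only [invSeries, ← tmul_self_pow he]
  refine sum_mem fun i _ => even_mul (even_mul (hpow (neg_mem ?_) _) (hpow ?_ _)) (hpow ?_ _)
  · exact SetLike.GradedOne.one_mem
  · exact tmul_mem_tensorPart he he (add_zero 0)
  · exact sub_mem hD (tmul_mem_tensorPart hd hd (add_zero 0))

theorem invSeries_mul [StrictlySupercommutative 𝒜] {e d : A} (he : e ∈ 𝒜 0) (hd : d ∈ 𝒜 0)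
    (hed : e * d = 1) {D : 𝒜 ᵍ⊗[k] 𝒜} (hD : D ∈ tensorPart 𝒜 𝒜 0)
    (hN : (D - d ᵍ⊗ₜ[k] d) ^ (m * n + 1) = 0) : invSeries 𝒜 m n e d D * D = 1 := by
  simp only [invSeries, ← tmul_self_pow he]
  refine even_sum_Icc_inv_mul (ℬ := tensorPart 𝒜 𝒜) (tmul_mem_tensorPart he he (add_zero 0))
    (tmul_mem_tensorPart hd hd (add_zero 0)) hD ?_
    (pow_eq_zero_of_le (by rw [mul_assoc]; omega) hN)
  rw [tmul_mul_tmul _ he hd, hed]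
  simp only [zero_mul, uzpow_zero, one_smul]
  rfl

namespace IsStandard

variable {g : Gen m n → A}

theorem includeLeft_gen_mem (hg : IsStandard 𝒜 g) (x : Gen m n) :
    (includeLeft 𝒜 𝒜 ∘ g) x ∈ tensorPart 𝒜 𝒜 x.parity := includeLeft_mem _ _ (hg.gen_mem x)

theorem includeRight_gen_mem (hg : IsStandard 𝒜 g) (x : Gen m n) :
    (includeRight 𝒜 𝒜 ∘ g) x ∈ tensorPart 𝒜 𝒜 x.parity := includeRight_mem _ _ (hg.gen_mem x)

theorem comulMatrix_mem (hg : IsStandard 𝒜 g) (i j : Fin m ⊕ Fin n) :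
    comulMatrix 𝒜 g i j ∈ tensorPart 𝒜 𝒜 (indexParity i + indexParity j) := by
  rw [comulMatrix, Matrix.of_apply]
  refine sum_mem fun l _ => tmul_mem_tensorPart (hg.gen_mem (.a i l)) (hg.gen_mem (.a l j)) ?_
  have h2 : indexParity l + indexParity l = 0 := CharTwo.add_self_eq_zero _
  change indexParity i + indexParity l + (indexParity l + indexParity j) = _
  rw [add_assoc, ← add_assoc (indexParity l), h2, zero_add]

theorem det_comulMatrix₁₁_mem (hg : IsStandard 𝒜 g) :
    det (comulMatrix 𝒜 g).toBlocks₁₁ ∈ tensorPart 𝒜 𝒜 0 :=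
  det_mem fun i j => hg.comulMatrix_mem (.inl i) (.inl j)

theorem det_comulMatrix₂₂_mem (hg : IsStandard 𝒜 g) :
    det (comulMatrix 𝒜 g).toBlocks₂₂ ∈ tensorPart 𝒜 𝒜 0 :=
  det_mem fun i j => hg.comulMatrix_mem (.inr i) (.inr j)

theorem comulGen_mem (hg : IsStandard 𝒜 g) (x : Gen m n) :
    comulGen 𝒜 g x ∈ tensorPart 𝒜 𝒜 x.parity := by
  rcases x with ⟨i, j⟩ | _ | _
  · exact hg.comulMatrix_mem i j
  · exact invSeries_mem (hg.gen_mem .dinv₁) (det_mem (X₁₁_mem hg.gen_mem)) hg.det_comulMatrix₁₁_mem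
  · exact invSeries_mem (hg.gen_mem .dinv₂) (det_mem (X₂₂_mem hg.gen_mem)) hg.det_comulMatrix₂₂_mem

variable [StrictlySupercommutative 𝒜]

/-- The series in `comulGen` is an inverse: the matrix `(a i l ⊗ a l j)` is the product of
`(a i j ⊗ 1)` and `(1 ⊗ a i j)`, so that the determinant of its block differs from `d ⊗ d` by a
nilpotent, whose power `m n + 1` vanishes. -/
theorem comulGen_inv₁ (hg : IsStandard 𝒜 g) :
    comulGen 𝒜 g .dinv₁ * det (X₁₁ (comulGen 𝒜 g)) = 1 := by
  refine invSeries_mul (hg.gen_mem .dinv₁) (det_mem (X₁₁_mem hg.gen_mem)) hg.inv₁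
    hg.det_comulMatrix₁₁_mem ?_
  have h := det_X₁₁_sub_pow_eq_zero hg.includeLeft_gen_mem hg.includeRight_gen_mem
    (superMatrix_comulGen g)
  rwa [← includeLeft_mul_includeRight, ← AlgHom.coe_toRingHom (includeLeft 𝒜 𝒜),
    ← AlgHom.coe_toRingHom (includeRight 𝒜 𝒜), map_det, map_det]

theorem comulGen_inv₂ (hg : IsStandard 𝒜 g) :
    comulGen 𝒜 g .dinv₂ * det (X₂₂ (comulGen 𝒜 g)) = 1 := by
  refine invSeries_mul (hg.gen_mem .dinv₂) (det_mem (X₂₂_mem hg.gen_mem)) hg.inv₂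
    hg.det_comulMatrix₂₂_mem ?_
  have h := det_X₂₂_sub_pow_eq_zero hg.includeLeft_gen_mem hg.includeRight_gen_mem
    (superMatrix_comulGen g)
  rw [mul_comm n m] at h
  rwa [← includeLeft_mul_includeRight, ← AlgHom.coe_toRingHom (includeLeft 𝒜 𝒜),
    ← AlgHom.coe_toRingHom (includeRight 𝒜 𝒜), map_det, map_det]

theorem ber_comulGen (hg : IsStandard 𝒜 g) :
    ber (comulGen 𝒜 g) = ber g ᵍ⊗ₜ[k] ber g := by
  rw [ber_mul hg.includeLeft_gen_mem hg.includeRight_gen_mem hg.comulGen_mem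
    (map_det_inv₂ (includeLeft 𝒜 𝒜).toRingHom (by rw [hg.inv₂, map_one]))
    (map_det_inv₂ (includeRight 𝒜 𝒜).toRingHom (by rw [hg.inv₂, map_one]))
    hg.comulGen_inv₂ (superMatrix_comulGen g), ← includeLeft_mul_includeRight]
  exact congrArg₂ (· * ·) (map_ber (includeLeft 𝒜 𝒜).toRingHom g).symm
    (map_ber (includeRight 𝒜 𝒜).toRingHom g).symm

/-- A morphism with the prescribed values on generators makes `A` a super bialgebra. -/
theorem exists_superBialgebra (hg : IsStandard 𝒜 g) (Δ : A →ₐ[k] 𝒜 ᵍ⊗[k] 𝒜) (ε : A →ₐ[k] k)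
    (hΔ : ∀ x, Δ (g x) = comulGen 𝒜 g x)
    (hε : ∀ x, ε (g x) = counitGen k x) :
    ∃ S : SuperBialgebra 𝒜, HasStandardFormulas S g ∧ ∀ a, S.Δ a = Δ a := by
  have hΔ₁ : Δ (det (X₁₁ g)) = det (comulMatrix 𝒜 g).toBlocks₁₁ :=
    (map_det Δ.toRingHom _).trans (congrArg det (Matrix.ext fun i j => hΔ _))
  have hΔ₂ : Δ (det (X₂₂ g)) = det (comulMatrix 𝒜 g).toBlocks₂₂ :=
    (map_det Δ.toRingHom _).trans (congrArg det (Matrix.ext fun i j => hΔ _))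
  have hΔmem : ∀ i, ∀ a ∈ 𝒜 i, Δ a ∈ tensorPart 𝒜 𝒜 i :=
    hg.map_mem fun x => by rw [hΔ]; exact hg.comulGen_mem x
  have hεmem : ∀ a ∈ 𝒜 1, ε a = 0 := by
    have hword (l : List (Gen m n)) (hl : (l.map Gen.parity).sum = 1) : ε (l.map g).prod = 0 := by
      induction l with
      | nil => simp at hl
      | cons x l ih =>
        simp only [List.map_cons, List.prod_cons, List.sum_cons, map_mul] at hl ⊢
        rcases parity_eq_zero_or_one x.parity with hx | hx
        · rw [hx, zero_add] at hl
          rw [ih hl, mul_zero]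
        · rw [hε, counitGen_eq_zero_of_odd x hx, zero_mul]
    intro a ha
    rw [hg.span] at ha
    refine (Submodule.span_le (p := LinearMap.ker ε.toLinearMap)).2 ?_ ha
    rintro _ ⟨l, hl, rfl⟩
    exact hword l hl
  have hΔa (i j) : Δ (g (.a i j)) = ∑ l, g (.a i l) ᵍ⊗ₜ[k] g (.a l j) := hΔ _
  refine ⟨superBialgebraOfAlgHom Δ ε hΔmem hεmem (hg.algHom_ext fun i j => ?_)
    (hg.algHom_ext fun i j => ?_) (hg.algHom_ext fun i j => ?_),
    ⟨hΔa, ?_, ?_, fun i j => hε _, hε _, hε _⟩, fun _ => rfl⟩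
  · have hsum (a : A) (z : Fin m ⊕ Fin n → 𝒜 ᵍ⊗[k] 𝒜) :
        (a ᵍ⊗ₜ[k] (∑ l, z l) : 𝒜 ᵍ⊗[k] tensorPart 𝒜 𝒜) = ∑ l, a ᵍ⊗ₜ[k] z l := by
      rw [GradedTensorProduct.tmul, TensorProduct.tmul_sum, map_sum]
    simp only [AlgHom.comp_apply, hΔa, map_sum, comulLeft_tmul, comulRight_tmul, Finset.sum_mul,
      tensorIncl_tmul_mul, hsum]
    exact Finset.sum_comm
  · simp [hΔa, counitLeft_tmul, hε, counitGen, -Fintype.sum_sum_type]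
  · simp [hΔa, counitRight_tmul, hε, counitGen, -Fintype.sum_sum_type]
  · exact (hΔ .dinv₁).trans (congrArg (invSeries 𝒜 m n _ _) hΔ₁.symm)
  · exact (hΔ .dinv₂).trans (congrArg (invSeries 𝒜 m n _ _) hΔ₂.symm)

end IsStandard

end Comul

/-! ### The coordinate superalgebras of `GL(m|n)` and `SL(m|n)` -/

section Coordinate

variable {k : Type*} [CommRing k] {m n : ℕ}

/-- A morphism maps the span of the words of parity `i` onto the span of the words in the images of
the generators. -/
theorem map_span_words {A C : Type*} [Ring A] [Algebra k A] [Ring C] [Algebra k C] (f : A →ₐ[k] C)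
    (g : Gen m n → A) (i : ZMod 2) :
    (Submodule.span k {w | ∃ l : List (Gen m n), (l.map Gen.parity).sum = i ∧
      w = (l.map g).prod}).map f.toLinearMap =
    Submodule.span k {w | ∃ l : List (Gen m n), (l.map Gen.parity).sum = i ∧
      w = (l.map (f ∘ g)).prod} := by
  rw [Submodule.map_span]
  congr 1
  ext w
  constructor
  · rintro ⟨_, ⟨l, hl, rfl⟩, rfl⟩
    exact ⟨l, hl, by simp [map_list_prod]⟩
  · rintro ⟨l, hl, rfl⟩
    exact ⟨_, ⟨l, hl, rfl⟩, by simp [map_list_prod]⟩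

theorem isStandard_GLAlg : IsStandard (GLAlg.part k m n) (GLAlg.gen k m n) where
  span i := map_span_words (RingQuot.mkAlgHom k (GLRel k m n)) (FreeAlgebra.ι k) i
  inv₁ := map_det_inv₁ (RingQuot.mkAlgHom k (GLRel k m n)).toRingHom
    ((RingQuot.mkAlgHom_rel k GLRel.inv₁).trans (map_one _))
  inv₂ := map_det_inv₂ (RingQuot.mkAlgHom k (GLRel k m n)).toRingHom
    ((RingQuot.mkAlgHom_rel k GLRel.inv₂).trans (map_one _))

theorem GLAlg.gen_mul_gen (x y : Gen m n) : GLAlg.gen k m n x * GLAlg.gen k m n y =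
    (-1 : ℤˣ) ^ (x.parity * y.parity) • (GLAlg.gen k m n y * GLAlg.gen k m n x) := by
  have h := RingQuot.mkAlgHom_rel k (GLRel.comm (k := k) x y)
  rw [map_mul, Units.smul_def, map_zsmul, map_mul] at h
  exact h

theorem GLAlg.gen_mul_self (x : Gen m n) (hx : x.parity = 1) :
    GLAlg.gen k m n x * GLAlg.gen k m n x = 0 := by
  have h := RingQuot.mkAlgHom_rel k (GLRel.sq (k := k) x hx)
  rw [map_mul, map_zero] at h
  exact h

instance : StrictlySupercommutative (GLAlg.part k m n) :=
  .of_gen isStandard_GLAlg.span GLAlg.gen_mul_gen GLAlg.gen_mul_self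

/-- The universal property of `k[GL(m|n)]`. -/
theorem GLAlg.exists_algHom {C : Type*} [Ring C] [Algebra k C] (h : Gen m n → C)
    (hcomm : ∀ x y, h x * h y = (-1 : ℤˣ) ^ (x.parity * y.parity) • (h y * h x))
    (hsq : ∀ x : Gen m n, x.parity = 1 → h x * h x = 0)
    (h₁ : h .dinv₁ * det (X₁₁ h) = 1) (h₂ : h .dinv₂ * det (X₂₂ h) = 1) :
    ∃ f : GLAlg k m n →ₐ[k] C, ∀ x, f (GLAlg.gen k m n x) = h x := by
  have hrel : ∀ ⦃a b⦄, GLRel k m n a b → FreeAlgebra.lift k h a = FreeAlgebra.lift k h b := by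
    intro a b hab
    cases hab with
    | comm x y =>
      rw [map_mul, Units.smul_def, map_zsmul, map_mul]
      simpa [Units.smul_def] using hcomm x y
    | sq x hx => simpa using hsq x hx
    | inv₁ =>
      rw [map_mul, map_one, FreeAlgebra.lift_ι_apply]
      refine (congrArg (_ * ·) ((map_det (FreeAlgebra.lift k h).toRingHom _).trans ?_)).trans h₁
      exact congrArg det (Matrix.ext fun i j => FreeAlgebra.lift_ι_apply h _)
    | inv₂ =>
      rw [map_mul, map_one, FreeAlgebra.lift_ι_apply]
      refine (congrArg (_ * ·) ((map_det (FreeAlgebra.lift k h).toRingHom _).trans ?_)).trans h₂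
      exact congrArg det (Matrix.ext fun i j => FreeAlgebra.lift_ι_apply h _)
  refine ⟨RingQuot.liftAlgHom k ⟨FreeAlgebra.lift k h, hrel⟩, fun x => ?_⟩
  exact (RingQuot.liftAlgHom_mkAlgHom_apply k _ hrel _).trans (FreeAlgebra.lift_ι_apply h x)

theorem det_one {C : Type*} [CommRing C] {r : ℕ} : det (1 : Matrix (Fin r) (Fin r) C) = 1 := by
  rw [det_eq_matrix_det, Matrix.det_one]

theorem X₁₁_counitGen : X₁₁ (counitGen k : Gen m n → k) = 1 := by
  ext i j
  simp [X₁₁, counitGen, Matrix.one_apply]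

theorem X₂₂_counitGen : X₂₂ (counitGen k : Gen m n → k) = 1 := by
  ext i j
  simp [X₂₂, counitGen, Matrix.one_apply]

theorem ber_counitGen : ber (counitGen k : Gen m n → k) = 1 := by
  have hΞ : Ξ₁₂ (counitGen k : Gen m n → k) = 0 := by
    ext i j
    simp [Ξ₁₂, counitGen]
  have hS : S₂₂ (counitGen k : Gen m n → k) = 1 := by
    rw [S₂₂, X₂₂_counitGen, cramerInv_eq_smul_adjugate, Matrix.adjugate_one]
    exact one_smul k _
  rw [ber, hS, hΞ, X₁₁_counitGen, Matrix.zero_mul, Matrix.zero_mul, sub_zero, det_one, det_one,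
    one_mul]

variable (k m n) in
theorem GLAlg.exists_counit :
    ∃ ε : GLAlg k m n →ₐ[k] k, ∀ x, ε (GLAlg.gen k m n x) = counitGen k x := by
  refine GLAlg.exists_algHom (counitGen k) (fun x y => ?_)
    (fun x hx => by rw [counitGen_eq_zero_of_odd x hx, zero_mul]) ?_ ?_
  · rcases parity_eq_zero_or_one x.parity with hx | hx
    · rw [hx, zero_mul, uzpow_zero, one_smul, mul_comm]
    · rw [counitGen_eq_zero_of_odd x hx, zero_mul, mul_zero, smul_zero]
  · rw [X₁₁_counitGen, det_one]
    exact one_mul 1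
  · rw [X₂₂_counitGen, det_one]
    exact one_mul 1

/-- The comultiplication of a supermatrix of generators, as a morphism from `k[GL(m|n)]`. -/
theorem GLAlg.exists_comul {A : Type*} [Ring A] [Algebra k A] {𝒜 : ZMod 2 → Submodule k A}
    [GradedAlgebra 𝒜] [StrictlySupercommutative 𝒜] {g : Gen m n → A} (hg : IsStandard 𝒜 g) :
    ∃ Δ : GLAlg k m n →ₐ[k] 𝒜 ᵍ⊗[k] 𝒜, ∀ x, Δ (GLAlg.gen k m n x) = comulGen 𝒜 g x :=
  GLAlg.exists_algHom (comulGen 𝒜 g)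
    (fun x y => StrictlySupercommutative.comm _ _ _ (hg.comulGen_mem x) _ (hg.comulGen_mem y))
    (fun x hx => odd_sq (ℬ := tensorPart 𝒜 𝒜) (hx ▸ hg.comulGen_mem x))
    hg.comulGen_inv₁ hg.comulGen_inv₂

theorem isStandard_SLAlg : IsStandard (SLAlg.part k m n) (SLAlg.gen k m n) where
  span i := by
    refine Eq.trans ?_ (map_span_words (RingQuot.mkAlgHom k (SLRel k m n)) (GLAlg.gen k m n) i)
    rw [← isStandard_GLAlg.span]
    rfl
  inv₁ := map_det_inv₁ (RingQuot.mkAlgHom k (SLRel k m n)).toRingHom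
    (by rw [isStandard_GLAlg.inv₁, map_one])
  inv₂ := map_det_inv₂ (RingQuot.mkAlgHom k (SLRel k m n)).toRingHom
    (by rw [isStandard_GLAlg.inv₂, map_one])

instance : StrictlySupercommutative (SLAlg.part k m n) :=
  .of_gen isStandard_SLAlg.span
    (fun x y => by
      have h := congrArg (RingQuot.mkAlgHom k (SLRel k m n)) (GLAlg.gen_mul_gen x y)
      rw [map_mul, Units.smul_def, map_zsmul, map_mul] at h
      exact h)
    (fun x hx => by
      have h := congrArg (RingQuot.mkAlgHom k (SLRel k m n)) (GLAlg.gen_mul_self x hx)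
      rw [map_mul, map_zero] at h
      exact h)

theorem ber_SLAlg_gen : ber (SLAlg.gen k m n) = 1 := by
  have h := RingQuot.mkAlgHom_rel k (SLRel.ber_eq_one (k := k) (m := m) (n := n))
  rw [map_one] at h
  exact (map_ber (RingQuot.mkAlgHom k (SLRel k m n)).toRingHom _).symm.trans h

/-- The universal property of `k[SL(m|n)]`. -/
theorem SLAlg.exists_algHom {C : Type*} [Ring C] [Algebra k C] (f : GLAlg k m n →ₐ[k] C)
    {h : Gen m n → C} (hf : ∀ x, f (GLAlg.gen k m n x) = h x) (hber : ber h = 1) :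
    ∃ f' : SLAlg k m n →ₐ[k] C, ∀ x, f' (SLAlg.gen k m n x) = h x := by
  have hrel : ∀ ⦃a b⦄, SLRel k m n a b → f a = f b := by
    rintro _ _ ⟨⟩
    rw [map_one, ← hber, ← funext hf]
    exact map_ber f.toRingHom _
  exact ⟨RingQuot.liftAlgHom k ⟨f, hrel⟩,
    fun x => (RingQuot.liftAlgHom_mkAlgHom_apply k _ hrel _).trans (hf x)⟩

end Coordinate

end SuperGroup

end

open SuperGroup in
theorem mainTheorem2 (k : Type*) [Field k] (m n : ℕ) :
    (IsSupercommutative (GLAlg.part k m n) ∧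
      ∃ S : SuperBialgebra (GLAlg.part k m n),
        HasStandardFormulas S (GLAlg.gen k m n) ∧
        S.Δ (ber (GLAlg.gen k m n)) =
          (ber (GLAlg.gen k m n) ᵍ⊗ₜ[k] ber (GLAlg.gen k m n))) ∧
    (IsSupercommutative (SLAlg.part k m n) ∧
      ∃ S : SuperBialgebra (SLAlg.part k m n),
        HasStandardFormulas S (SLAlg.gen k m n)) := by
  obtain ⟨ε, hε⟩ := GLAlg.exists_counit k m n
  refine ⟨⟨StrictlySupercommutative.comm, ?_⟩, StrictlySupercommutative.comm, ?_⟩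
  · have hg := isStandard_GLAlg (k := k) (m := m) (n := n)
    obtain ⟨Δ, hΔ⟩ := GLAlg.exists_comul hg
    obtain ⟨S, hS, hSΔ⟩ := hg.exists_superBialgebra Δ ε hΔ hε
    refine ⟨S, hS, ?_⟩
    rw [hSΔ, ← hg.ber_comulGen, ← funext hΔ]
    exact map_ber Δ.toRingHom _
  · have hg := isStandard_SLAlg (k := k) (m := m) (n := n)
    obtain ⟨Δ, hΔ⟩ := GLAlg.exists_comul hg
    have hber : ber (comulGen (SLAlg.part k m n) (SLAlg.gen k m n)) = 1 := by
      rw [hg.ber_comulGen, ber_SLAlg_gen]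
      rfl
    -- both morphisms take the value `1` on the Berezinian, hence factor through `k[SL(m|n)]`
    obtain ⟨Δ', hΔ'⟩ := SLAlg.exists_algHom Δ hΔ hber
    obtain ⟨ε', hε'⟩ := SLAlg.exists_algHom ε hε ber_counitGen
    obtain ⟨S, hS, -⟩ := hg.exists_superBialgebra Δ' ε' hΔ' hε'
    exact ⟨S, hS⟩
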